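/- Let $d\ge 1$ and $n,p\ge 1$ be integers. For $\kappa,\rho\in[0,\infty)$ let $Y^\rho_1,\dots,Y^\rho_n$ be independent continuous-time simple random walks on $\mathbb Z^d$ with step rate $2d\rho$, all started from the origin, with joint expectation $\mathbb E_0^{\otimes n}$, and let $\xi(x,t)=\sum_{k=1}^n \mathbf 1\{Y^\rho_k(t)=x\}$. For $x\in\mathbb Z^d$ let $\mathrm E_x$ be the expectation over a continuous-time simple random walk $X^\kappa$ on $\mathbb Z^d$ with step rate $2d\kappa$, started from $x$ and independent of the $Y^\rho_k$, and let $$u(x,t)=\mathrm E_x\Big(\exp\Big[\int_0^t \xi\big(X^\kappa(s),t-s\big)\,ds\Big]\Big)$$ be the (Feynman–Kac) solution of the parabolic Anderson model $\partial_t u=\kappa\Delta u+\xi u$, $u(\cdot,0)=1$, where $\Delta f(x)=\sum_{|y-x|=1}[f(y)-f(x)]$. Put $\Lambda_p(t)=\frac1t\log\big(\mathbb E_0^{\otimes n}([u(x,t)]^p)^{1/p}\big)$ for $t>0$. (i) For all $\kappa,\rho\in[0,\infty)$ and every $x\in\mathbb Z^d$, the limit $\lim_{t\to\infty}\Lambda_p(t)$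 exists and is finite. If $(\kappa,\rho)\neq(0,0)$, it does not depend on $x$. (ii) Let $\lambda_p^{(n)}(\kappa,\rho)$ denote the limit in (i) for the starting point $x=0$ (by (i), the choice of starting point matters only at $(\kappa,\rho)=(0,0)$). The function $(\kappa,\rho)\mapsto\lambda_p^{(n)}(\kappa,\rho)$ is continuous and (jointly) convex on $[0,\infty)^2$, and non-increasing in each of $\kappa$ and $\rho$. -/

import Mathlib

open MeasureTheory ProbabilityTheory Filter Topology
open scoped NNReal ENNReal

noncomputable section

/-- The uniform distribution on the `2d` nearest neighbours `± eᵢ` of the origin of `ℤ^d`. -/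
def stepLaw (d : ℕ) : Measure (Fin d → ℤ) :=
  ∑ i : Fin d, ((2 * d : ℝ≥0∞)⁻¹) •
    (Measure.dirac (Pi.single i (1 : ℤ)) + Measure.dirac (Pi.single i (-1 : ℤ)))

/-- The law of the sum of `k` independent uniform nearest-neighbour steps. -/
def stepsLaw (d : ℕ) : ℕ → Measure (Fin d → ℤ)
  | 0 => Measure.dirac 0
  | k + 1 => Measure.conv (stepsLaw d k) (stepLaw d)

/-- The law of the displacement during a time span `t` of the continuous-time simple random walk
on `ℤ^d` with step rate `2dκ`: the number of steps is Poisson with parameter `2dκt`, and the steps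
are independent and uniform on the nearest neighbours. -/
def displacementLaw (d : ℕ) (κ t : ℝ≥0) : Measure (Fin d → ℤ) :=
  Measure.sum fun k : ℕ => (poissonMeasure (2 * d * κ * t)) {k} • stepsLaw d k

/-- `X` is, under `P`, a continuous-time simple random walk on `ℤ^d` with step rate `2dκ` that
starts from `x`: a càdlàg process with independent increments, whose increment over `[s, t]` is
distributed as the displacement of the walk during the time `t - s`. -/
structure IsSimpleRandomWalk {d : ℕ} {Ω : Type*} [MeasurableSpace Ω] (κ : ℝ≥0) (x : Fin d → ℤ)
    (X : ℝ≥0 → Ω → (Fin d → ℤ)) (P : Measure Ω) : Prop where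
  measurable : ∀ t, Measurable (X t)
  start : ∀ ω, X 0 ω = x
  right_continuous : ∀ ω t, ContinuousWithinAt (fun s => X s ω) (Set.Ici t) t
  left_limits : ∀ ω t, ∃ l, Tendsto (fun s => X s ω) (𝓝[<] t) (𝓝 l)
  indep_increments : HasIndepIncrements X P
  increment_law : ∀ s t, s ≤ t → HasLaw (fun ω => X t ω - X s ω) (displacementLaw d κ (t - s)) P

/-- The catalytic field `ξ(x, t)`: the number of walkers `Y₁, …, Yₙ` that are at `x` at time `t`. -/
def catalyst {d n : ℕ} {Ω : Type*} (Y : Fin n → ℝ≥0 → Ω → (Fin d → ℤ)) (ω : Ω)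
    (x : Fin d → ℤ) (t : ℝ≥0) : ℝ :=
  ∑ k : Fin n, if Y k t ω = x then 1 else 0

/-- The Feynman-Kac solution `u(x, t) = E_x exp (∫₀ᵗ ξ(X(s), t - s) ds)` of the parabolic Anderson
model `∂u/∂t = κ Δ u + ξ u`, `u(·, 0) = 1`, in the environment given by `ω`. Here `X`, under `Q`, is
the simple random walk with step rate `2dκ` that starts from `x`. -/
def pamSolution {d n : ℕ} {Ω Ω' : Type*} [MeasurableSpace Ω']
    (Y : Fin n → ℝ≥0 → Ω → (Fin d → ℤ)) (X : ℝ≥0 → Ω' → (Fin d → ℤ)) (Q : Measure Ω')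
    (t : ℝ≥0) (ω : Ω) : ℝ :=
  ∫ ω', Real.exp (∫ s in (0 : ℝ)..t, catalyst Y ω (X s.toNNReal ω') (t - s.toNNReal)) ∂Q

/-- `Λ_p(t) = (1/t) log (E [u(x, t)^p])^(1/p)`. -/
def momentRate {d n : ℕ} {Ω Ω' : Type*} [MeasurableSpace Ω] [MeasurableSpace Ω'] (p : ℕ)
    (Y : Fin n → ℝ≥0 → Ω → (Fin d → ℤ)) (P : Measure Ω)
    (X : ℝ≥0 → Ω' → (Fin d → ℤ)) (Q : Measure Ω') (t : ℝ≥0) : ℝ :=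
  (1 / (t : ℝ)) * Real.log ((∫ ω, pamSolution Y X Q t ω ^ p ∂P) ^ (1 / (p : ℝ)))

end

/-! Expanding the `p`-th power of the Feynman-Kac formula writes the moment as the expectation of
the exponential of a total contact time between `p` copies of `X` and the walkers `Y`. Reading the
walkers backwards, as `Y k (t - s)`, puts all `p + n` walks on one clock. The joint path is a random
walk on (ℤ^d)^(p+n) whose potential is the number V of contacts. Its generator with potential, H = κ
∑ Δ_j + ρ ∑ Δ_k + V, is a bounded symmetric operator on ℓ². Fixing the total displacement c also
fixes the otherwise random initial configuration, and the corresponding part of the moment is one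
entry of the kernel of exp(tH) (`integral_exp_totalExposure`). This is proved by a Trotter product
formula for the operators (`tendsto_stepOp_pow`) together with Riemann sums for the contact time
(`tendsto_exposureSum`).

Let E be the top of the spectrum of H. The logarithm of the moment, divided by t, tends to E unless
both rates vanish and `x ≠ 0`. Upper bound (`moment_le`): every kernel entry is at most exp(tE), a
box of radius of order t contains polynomially many displacements, and larger displacements are
suppressed by an exponential Chebyshev bound. Lower bound: only displacement zero is kept, which
leaves a return kernel. Jensen's inequality for spectral measures gives exp(t⟨f, Hf⟩) ≤ ⟨f,
exp(tH)f⟩ for unit f; if f has finite support inside the set reachable from the starting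
configuration, positivity bounds the right side by a constant times the return kernel at a time two
units later (`exists_mul_exp_le_kernelFK`).

It remains to see that test functions on reachable configurations determine E. This is immediate if
both rates are positive. If the particles of one kind are frozen, H is an average of operators, each
of which behaves as if all frozen particles shared one site, so stacking them at the starting site
loses no energy (`inner_hamiltonian_le_of_frozen`). If both rates vanish and `x = 0`, the starting
configuration maximizes V. If both vanish and `x ≠ 0`, there are almost surely no contacts and the
limit is 0.

Hence the exponent is E / p, with no dependence on x away from the degenerate case. As a supremum
over unit f of functions affine in (κ, ρ), with slopes that are nonpositive and uniformly bounded, E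
is convex, non-increasing in each rate and Lipschitz. -/

set_option linter.unusedSectionVars false

/-! ### Powers of near-identity elements and the exponential -/

section BanachAlgebra

variable {𝔸 : Type*} [NormedRing 𝔸]

theorem norm_pow_sub_pow_le_mul_pow (a b : 𝔸) {m : ℝ} (h1 : ‖(1 : 𝔸)‖ ≤ 1) (ha : ‖a‖ ≤ m)
    (hb : ‖b‖ ≤ m) (hm : 1 ≤ m) (n : ℕ) : ‖a ^ n - b ^ n‖ ≤ n * ‖a - b‖ * m ^ n := by
  have hpow : ∀ (c : 𝔸), ‖c‖ ≤ m → ∀ k : ℕ, ‖c ^ k‖ ≤ m ^ k := by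
    intro c hc k
    induction k with
    | zero => simpa using h1
    | succ k ih =>
      rw [pow_succ, pow_succ]
      exact (norm_mul_le _ _).trans (mul_le_mul ih hc (norm_nonneg _) (by positivity))
  induction n with
  | zero => simp
  | succ n ih =>
    -- Telescoping: the factors are exchanged one at a time, in an order that needs no
    -- commutativity.
    have e : a ^ (n + 1) - b ^ (n + 1) = a ^ n * (a - b) + (a ^ n - b ^ n) * b := by
      rw [pow_succ, pow_succ]; noncomm_ring
    have hmn : (0 : ℝ) ≤ m ^ n := by positivity
    calc ‖a ^ (n + 1) - b ^ (n + 1)‖ ≤ ‖a ^ n‖ * ‖a - b‖ + ‖a ^ n - b ^ n‖ * ‖b‖ := by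
          rw [e]
          exact (norm_add_le _ _).trans (add_le_add (norm_mul_le _ _) (norm_mul_le _ _))
      _ ≤ m ^ n * ‖a - b‖ + (n * ‖a - b‖ * m ^ n) * m := by
          gcongr
          exact hpow a ha n
      _ ≤ m ^ (n + 1) * ‖a - b‖ + (n * ‖a - b‖ * m ^ n) * m := by
          gcongr; simp
      _ = _ := by push_cast; ring

/-- If `k (A k - 1)` tends to `X`, then `A k ^ k` tends to the exponential of `X`. -/
theorem tendsto_pow_exp_of_tendsto_mul_sub_one [NormedAlgebra ℝ 𝔸] [CompleteSpace 𝔸]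
    (h1 : ‖(1 : 𝔸)‖ ≤ 1) (A : ℕ → 𝔸) (X : 𝔸) (hA : Tendsto (fun k : ℕ => (k : ℝ) • (A k - 1)) atTop (𝓝 X)) :
    Tendsto (fun k => A k ^ k) atTop (𝓝 (NormedSpace.exp X)) := by
  let +nondep : NormedAlgebra ℚ 𝔸 := .restrictScalars ℚ ℝ 𝔸
  -- The comparison element is the exact `k`-th root of exp X. Both `A k` and `B k` equal 1 + X/k up
  -- to o(1/k), so `k * ‖A k - B k‖` tends to 0, while products of `k` such factors stay bounded by
  -- exp(‖X‖ + 1).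
  set B : ℕ → 𝔸 := fun k => NormedSpace.exp (((k : ℝ)⁻¹) • X) with hB
  have hBpow : ∀ k : ℕ, k ≠ 0 → B k ^ k = NormedSpace.exp X := by
    intro k hk
    rw [hB, ← NormedSpace.exp_nsmul, ← Nat.cast_smul_eq_nsmul ℝ, smul_smul,
      mul_inv_cancel₀ (by positivity), one_smul]
  have hBt : Tendsto (fun k : ℕ => (k : ℝ) • (B k - 1)) atTop (𝓝 X) := by
    have hd := hasDerivAt_exp_smul_const (𝕂 := ℝ) X (0 : ℝ)
    rw [zero_smul, NormedSpace.exp_zero, one_mul] at hd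
    have := hd.tendsto_slope_zero
    have h2 : Tendsto (fun k : ℕ => ((k : ℝ)⁻¹)) atTop (𝓝[≠] 0) := by
      refine tendsto_nhdsWithin_iff.2 ⟨tendsto_inv_atTop_nhds_zero_nat, ?_⟩
      filter_upwards [eventually_ne_atTop 0] with k hk
      simpa using hk
    refine (this.comp h2).congr fun k => ?_
    simp [hB, NormedSpace.exp_zero]
  have hdiff : Tendsto (fun k : ℕ => (k : ℝ) * ‖A k - B k‖) atTop (𝓝 0) := by
    have h := (hA.sub hBt).norm
    rw [sub_self, norm_zero] at h
    refine h.congr fun k => ?_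
    rw [← smul_sub, norm_smul, sub_sub_sub_cancel_right]
    simp
  have hbd : ∀ (C : ℕ → 𝔸), Tendsto (fun k : ℕ => (k : ℝ) • (C k - 1)) atTop (𝓝 X) →
      ∀ᶠ k : ℕ in atTop, ‖C k‖ ≤ 1 + (‖X‖ + 1) / k := by
    intro C hC
    filter_upwards [hC.norm.eventually (ge_mem_nhds (lt_add_one ‖X‖)), eventually_gt_atTop 0]
      with k hk hk0
    have hk0' : (0 : ℝ) < k := by exact_mod_cast hk0
    rw [norm_smul, Real.norm_of_nonneg hk0'.le] at hk
    have : ‖C k‖ ≤ ‖C k - 1‖ + ‖(1 : 𝔸)‖ := by simpa using norm_add_le (C k - 1) 1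
    have : ‖C k - 1‖ ≤ (‖X‖ + 1) / k := by rw [le_div_iff₀ hk0']; linarith
    linarith
  rw [tendsto_iff_norm_sub_tendsto_zero]
  have hup : Tendsto (fun k : ℕ => (k : ℝ) * ‖A k - B k‖ * Real.exp (‖X‖ + 1)) atTop (𝓝 0) := by
    simpa using hdiff.mul_const (Real.exp (‖X‖ + 1))
  refine squeeze_zero' (Eventually.of_forall fun _ => norm_nonneg _) ?_ hup
  filter_upwards [hbd A hA, hbd B hBt, eventually_ne_atTop 0] with k ha hb hk
  rw [← hBpow k hk]
  have hX : 0 ≤ ‖X‖ := norm_nonneg X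
  refine (norm_pow_sub_pow_le_mul_pow _ _ h1 ha hb ?_ k).trans ?_
  · have : 0 ≤ (‖X‖ + 1) / (k : ℝ) := by positivity
    linarith
  · gcongr
    calc (1 + (‖X‖ + 1) / (k : ℝ)) ^ k ≤ Real.exp ((‖X‖ + 1) / k) ^ k := by
          gcongr
          rw [add_comm]; exact Real.add_one_le_exp _
      _ = Real.exp (‖X‖ + 1) := by
          rw [← Real.exp_nat_mul, mul_div_cancel₀]; exact_mod_cast hk

end BanachAlgebra

/-! ### Semigroups of bounded operators on a Hilbert space -/

section Hilbert

variable {E : Type*} [NormedAddCommGroup E] [InnerProductSpace ℝ E] [CompleteSpace E]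

theorem exp_add_smul_apply (T : E →L[ℝ] E) (s t : ℝ) (v : E) :
    NormedSpace.exp ((s + t) • T) v = NormedSpace.exp (s • T) (NormedSpace.exp (t • T) v) := by
  let +nondep : NormedAlgebra ℚ (E →L[ℝ] E) := .restrictScalars ℚ ℝ _
  rw [add_smul, NormedSpace.exp_add_of_commute]
  · rfl
  · exact ((Commute.refl T).smul_left s).smul_right t

theorem exp_smul_sub_smul_one (T : E →L[ℝ] E) (t c : ℝ) :
    NormedSpace.exp (t • (T - c • 1)) = Real.exp (-(t * c)) • NormedSpace.exp (t • T) := by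
  let +nondep : NormedAlgebra ℚ (E →L[ℝ] E) := .restrictScalars ℚ ℝ _
  have : t • (T - c • (1 : E →L[ℝ] E)) = (algebraMap ℝ (E →L[ℝ] E) (-(t * c))) + t • T := by
    rw [Algebra.algebraMap_eq_smul_one, smul_sub, smul_smul, neg_smul]; abel
  rw [this, NormedSpace.exp_add_of_commute (Algebra.commutes _ _),
    ← NormedSpace.algebraMap_exp_comm, ← Real.exp_eq_exp_ℝ, Algebra.algebraMap_eq_smul_one, smul_mul_assoc, one_mul]

theorem hasDerivAt_exp_smul_apply (T : E →L[ℝ] E) (v : E) (t : ℝ) :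
    HasDerivAt (fun t : ℝ => NormedSpace.exp (t • T) v) (T (NormedSpace.exp (t • T) v)) t := by
  have := (hasDerivAt_exp_smul_const' (𝕂 := ℝ) T t)
  simpa using this.clm_apply (hasDerivAt_const t v)

/-- After subtracting `m`, the quadratic form is nonpositive, so the squared norm along the
semigroup has nonpositive derivative. -/
theorem norm_exp_smul_apply_le {T : E →L[ℝ] E} {m : ℝ}
    (hT : ∀ v, inner ℝ v (T v) ≤ m * ‖v‖ ^ 2) {t : ℝ} (ht : 0 ≤ t) (v : E) :
    ‖NormedSpace.exp (t • T) v‖ ≤ Real.exp (t * m) * ‖v‖ := by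
  set T' := T - m • (1 : E →L[ℝ] E)
  have hneg : ∀ v, inner ℝ v (T' v) ≤ 0 := by
    intro v
    have := hT v
    simp only [T', sub_apply, smul_apply,
      one_apply_eq_self, inner_sub_right, inner_smul_right, real_inner_self_eq_norm_sq]
    linarith
  have hder : ∀ s : ℝ, HasDerivAt (fun s : ℝ => ‖NormedSpace.exp (s • T') v‖ ^ 2)
      (2 * inner ℝ (NormedSpace.exp (s • T') v) (T' (NormedSpace.exp (s • T') v))) s :=
    fun s => (hasDerivAt_exp_smul_apply T' v s).norm_sq
  have hanti : Antitone (fun s : ℝ => ‖NormedSpace.exp (s • T') v‖ ^ 2) := by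
    refine antitone_of_deriv_nonpos (fun s => (hder s).differentiableAt) fun s => ?_
    rw [(hder s).deriv]
    linarith [hneg (NormedSpace.exp (s • T') v)]
  have h0 := hanti ht
  simp only [zero_smul, NormedSpace.exp_zero, one_apply_eq_self] at h0
  have h1 : ‖NormedSpace.exp (t • T') v‖ ≤ ‖v‖ :=
    (pow_le_pow_iff_left₀ (norm_nonneg _) (norm_nonneg _) two_ne_zero).1 h0
  rw [exp_smul_sub_smul_one, smul_apply, norm_smul, Real.norm_eq_abs,
    Real.abs_exp, Real.exp_neg, ← div_eq_inv_mul, div_le_iff₀ (Real.exp_pos _)] at h1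
  linarith

theorem inner_exp_smul_comm {T : E →L[ℝ] E} (hT : ∀ v w, inner ℝ (T v) w = inner ℝ v (T w))
    (t : ℝ) (v w : E) :
    inner ℝ (NormedSpace.exp (t • T) v) w = inner ℝ v (NormedSpace.exp (t • T) w) := by
  have h : IsSelfAdjoint (t • T) :=
    IsSelfAdjoint.smul (by simp [IsSelfAdjoint])
      (ContinuousLinearMap.isSelfAdjoint_iff_isSymmetric.2 hT)
  exact ContinuousLinearMap.isSelfAdjoint_iff_isSymmetric.1 h.exp v w

/-- Jensen's inequality for the spectral measure of a unit vector. -/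
theorem exp_inner_le_inner_exp {T : E →L[ℝ] E} (hT : ∀ v w, inner ℝ (T v) w = inner ℝ v (T w))
    {f : E} (hf : ‖f‖ = 1) {t : ℝ} (ht : 0 ≤ t) :
    Real.exp (t * inner ℝ f (T f)) ≤ inner ℝ f (NormedSpace.exp (t • T) f) := by
  set R := inner ℝ f (T f) with hR
  -- With the mean energy removed, g(s) = ⟨f, exp(sT')f⟩ has g'(0) = 0 and g''(s) = ‖exp(sT'/2)
  -- T'f‖² ≥ 0. So g increases from g(0) = 1 on the half-line, and no spectral theorem is needed.
  set T' := T - R • (1 : E →L[ℝ] E)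
  have hT' : ∀ v w, inner ℝ (T' v) w = inner ℝ v (T' w) := by
    intro v w
    simp [T', inner_sub_left, inner_sub_right, inner_smul_left, inner_smul_right, hT v w]
  have hder : ∀ (g : E) (s : ℝ), HasDerivAt (fun s : ℝ => inner ℝ g (NormedSpace.exp (s • T') f))
      (inner ℝ g (T' (NormedSpace.exp (s • T') f))) s := by
    intro g s
    simpa using (hasDerivAt_const s g).inner ℝ (hasDerivAt_exp_smul_apply T' f s)
  have hder2 : ∀ s : ℝ, HasDerivAt (fun s : ℝ => inner ℝ f (T' (NormedSpace.exp (s • T') f)))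
      (inner ℝ (T' f) (T' (NormedSpace.exp (s • T') f))) s := by
    intro s
    refine (hder (T' f) s).congr_of_eventuallyEq (Eventually.of_forall fun s => ?_)
    exact (hT' _ _).symm
  have hpos : ∀ s : ℝ, 0 ≤ inner ℝ (T' f) (T' (NormedSpace.exp (s • T') f)) := by
    intro s
    have hc : ∀ v, T' (NormedSpace.exp ((s / 2) • T') v) =
        NormedSpace.exp ((s / 2) • T') (T' v) := by
      intro v
      have h : Commute T' (NormedSpace.exp ((s / 2) • T')) :=
        ((Commute.refl T').smul_right (s / 2)).exp_right
      exact congrArg (fun A : E →L[ℝ] E => A v) h.eq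
    have e : s = s / 2 + s / 2 := by ring
    rw [e, exp_add_smul_apply, hc, ← inner_exp_smul_comm hT', ← hc]
    exact real_inner_self_nonneg
  have hmono : Monotone (fun s : ℝ => inner ℝ f (T' (NormedSpace.exp (s • T') f))) := by
    refine monotone_of_deriv_nonneg (fun s => (hder2 s).differentiableAt) fun s => ?_
    rw [(hder2 s).deriv]; exact hpos s
  have h0 : inner ℝ f (T' f) = 0 := by
    simp only [T', sub_apply, smul_apply,
      one_apply_eq_self, inner_sub_right, inner_smul_right, real_inner_self_eq_norm_sq,
      hf, ← hR]
    ring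
  have hmono2 : MonotoneOn (fun s : ℝ => inner ℝ f (NormedSpace.exp (s • T') f)) (Set.Ici 0) := by
    refine monotoneOn_of_deriv_nonneg (convex_Ici 0)
      (fun s _ => (hder f s).continuousAt.continuousWithinAt)
      (fun s _ => (hder f s).differentiableAt.differentiableWithinAt) fun s hs => ?_
    rw [interior_Ici] at hs
    rw [(hder f s).deriv]
    have := hmono (le_of_lt hs)
    simp only [zero_smul, NormedSpace.exp_zero, one_apply_eq_self, h0] at this
    exact this
  have h := hmono2 (Set.mem_Ici.2 le_rfl) ht ht
  simp only [zero_smul, NormedSpace.exp_zero, one_apply_eq_self,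
    real_inner_self_eq_norm_sq, hf, one_pow] at h
  rw [exp_smul_sub_smul_one, smul_apply, inner_smul_right, Real.exp_neg,
    ← div_eq_inv_mul, le_div_iff₀ (Real.exp_pos _), one_mul] at h
  exact h

end Hilbert

/-! ### Operators on square-summable functions -/

noncomputable section

/-- Real square-summable functions on `S`. -/
abbrev L2 (S : Type*) := lp (fun _ : S => ℝ) 2

namespace L2

variable {S : Type*}

theorem hasSum_mul (f g : L2 S) : HasSum (fun z => f z * g z) (inner ℝ f g) := by
  simpa [mul_comm] using lp.hasSum_inner (𝕜 := ℝ) f g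

theorem hasSum_sq (f : L2 S) : HasSum (fun z => f z ^ 2) (‖f‖ ^ 2) := by
  simpa [sq, real_inner_self_eq_norm_mul_norm] using hasSum_mul f f

theorem memℓp_two_iff (f : S → ℝ) : Memℓp f 2 ↔ Summable fun z => f z ^ 2 := by
  rw [memℓp_gen_iff (by simp)]
  simp

/-- By injectivity the sum over `A` is a subsum of ‖f‖². This one bound serves multiplication
operators, translations and the slices used for frozen particles. -/
theorem indicator_comp_summable {σ : S → S} {A : Set S} (hσ : Set.InjOn σ A) (f : L2 S) :
    Summable (A.indicator fun z => f (σ z) ^ 2) ∧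
      ∑' z, A.indicator (fun z => f (σ z) ^ 2) z ≤ ‖f‖ ^ 2 := by
  have hinj : Function.Injective fun z : A => σ z := fun a b h => Subtype.ext (hσ a.2 b.2 h)
  have hs := (hasSum_sq f).summable
  have h1 : Summable fun z : A => f (σ z) ^ 2 := hs.comp_injective hinj
  refine ⟨summable_subtype_iff_indicator.1 h1, ?_⟩
  rw [← tsum_subtype A fun z => f (σ z) ^ 2, ← (hasSum_sq f).tsum_eq]
  exact tsum_comp_le_tsum_of_inj hs (fun _ => sq_nonneg _) hinj

theorem sq_weight_mul_le {w : S → ℝ} {σ : S → S} {C : ℝ} (hw : ∀ z, |w z| ≤ C) (f : L2 S) (z : S) :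
    (w z * f (σ z)) ^ 2 ≤ C ^ 2 * {z | w z ≠ 0}.indicator (fun z => f (σ z) ^ 2) z := by
  by_cases hz : w z = 0
  · simp [hz]
  · rw [Set.indicator_of_mem (by simpa using hz), mul_pow]
    have : w z ^ 2 ≤ C ^ 2 := sq_le_sq' (by linarith [neg_abs_le (w z), hw z])
      ((le_abs_self _).trans (hw z))
    gcongr

/-- The linear map `f ↦ w · (f ∘ σ)`, for a bounded weight `w` on whose support `σ` is injective. -/
def weightedCompLinear (w : S → ℝ) (σ : S → S) (C : ℝ) (hw : ∀ z, |w z| ≤ C)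
    (hσ : Set.InjOn σ {z | w z ≠ 0}) : L2 S →ₗ[ℝ] L2 S where
  toFun f := ⟨fun z => w z * f (σ z), (memℓp_two_iff _).2
    (((indicator_comp_summable hσ f).1.mul_left (C ^ 2)).of_nonneg_of_le
      (fun _ => sq_nonneg _) (sq_weight_mul_le hw f))⟩
  map_add' f g := by
    ext z
    exact mul_add _ _ _
  map_smul' c f := by
    ext z
    exact mul_left_comm _ _ _

theorem norm_weightedCompLinear_le {w : S → ℝ} {σ : S → S} {C : ℝ} (hw : ∀ z, |w z| ≤ C)
    (hσ : Set.InjOn σ {z | w z ≠ 0}) (f : L2 S) :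
    ‖weightedCompLinear w σ C hw hσ f‖ ≤ |C| * ‖f‖ := by
  refine (pow_le_pow_iff_left₀ (norm_nonneg _) (by positivity) two_ne_zero).1 ?_
  have h := indicator_comp_summable hσ f
  have hsq := hasSum_sq (weightedCompLinear w σ C hw hσ f)
  rw [mul_pow, sq_abs, ← hsq.tsum_eq]
  calc _ ≤ ∑' z, C ^ 2 * {z | w z ≠ 0}.indicator (fun z => f (σ z) ^ 2) z :=
        Summable.tsum_le_tsum (sq_weight_mul_le hw f) hsq.summable (h.1.mul_left _)
    _ ≤ _ := by
        rw [tsum_mul_left]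
        exact mul_le_mul_of_nonneg_left h.2 (sq_nonneg C)

/-- The operator `f ↦ w · (f ∘ σ)`, for a bounded weight `w` on whose support `σ` is injective. -/
def weightedComp (w : S → ℝ) (σ : S → S) (C : ℝ) (hw : ∀ z, |w z| ≤ C)
    (hσ : Set.InjOn σ {z | w z ≠ 0}) : L2 S →L[ℝ] L2 S :=
  (weightedCompLinear w σ C hw hσ).mkContinuous |C| (norm_weightedCompLinear_le hw hσ)

@[simp]
theorem weightedComp_apply {w : S → ℝ} {σ : S → S} {C : ℝ} (hw : ∀ z, |w z| ≤ C)
    (hσ : Set.InjOn σ {z | w z ≠ 0}) (f : L2 S) (z : S) :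
    weightedComp w σ C hw hσ f z = w z * f (σ z) := rfl

theorem norm_weightedComp_le {w : S → ℝ} {σ : S → S} {C : ℝ} (hw : ∀ z, |w z| ≤ C)
    (hσ : Set.InjOn σ {z | w z ≠ 0}) : ‖weightedComp w σ C hw hσ‖ ≤ |C| :=
  LinearMap.mkContinuous_norm_le _ (abs_nonneg C) _

/-- Evaluation at a point, as a continuous linear functional. -/
def evalCLM (z : S) : L2 S →L[ℝ] ℝ :=
  LinearMap.mkContinuous
    { toFun := fun f => f z
      map_add' := fun _ _ => rfl
      map_smul' := fun _ _ => rfl } 1 fun f => by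
        rw [one_mul]
        exact lp.norm_apply_le_norm (p := 2) (by simp) f z

@[simp]
theorem evalCLM_apply (z : S) (f : L2 S) : evalCLM z f = f z := rfl

theorem sum_apply {ι : Type*} (s : Finset ι) (f : ι → L2 S) (z : S) :
    (∑ i ∈ s, f i) z = ∑ i ∈ s, f i z := map_sum (evalCLM z) f s

theorem hasSum_exp_apply (A : L2 S →L[ℝ] L2 S) (f : L2 S) (z : S) :
    HasSum (fun k : ℕ => ((k.factorial : ℝ)⁻¹) * (A ^ k) f z) (NormedSpace.exp A f z) := by
  simpa using (NormedSpace.exp_series_hasSum_exp' (𝕂 := ℝ) A).mapL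
    ((evalCLM z).comp (ContinuousLinearMap.apply ℝ (L2 S) f))

/-- Multiplication by a bounded function. -/
def mulOp (V : S → ℝ) (C : ℝ) (hV : ∀ z, |V z| ≤ C) : L2 S →L[ℝ] L2 S :=
  weightedComp V id C hV (Set.injOn_id _)

@[simp]
theorem mulOp_apply {V : S → ℝ} {C : ℝ} (hV : ∀ z, |V z| ≤ C) (f : L2 S) (z : S) :
    mulOp V C hV f z = V z * f z := rfl

theorem exp_smul_mulOp_apply {V : S → ℝ} {C : ℝ} (hV : ∀ z, |V z| ≤ C) (h : ℝ) (f : L2 S) (z : S) :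
    NormedSpace.exp (h • mulOp V C hV) f z = Real.exp (h * V z) * f z := by
  have hpow : ∀ k : ℕ, ((h • mulOp V C hV) ^ k) f z = (h * V z) ^ k * f z := by
    intro k
    induction k with
    | zero => simp
    | succ k ih =>
      rw [pow_succ', mul_apply_eq_comp, smul_apply, lp.coeFn_smul, Pi.smul_apply,
        mulOp_apply, ih, smul_eq_mul]
      ring
  have h2 := (NormedSpace.exp_series_hasSum_exp' (𝕂 := ℝ) (h * V z)).mul_right (f z)
  rw [← Real.exp_eq_exp_ℝ] at h2
  refine (hasSum_exp_apply (h • mulOp V C hV) f z).unique (h2.congr_fun fun k => ?_)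
  rw [hpow, smul_eq_mul, mul_assoc]

section Shift

variable [AddCommGroup S]

/-- Translation `f ↦ f (· + c)`. -/
def shift (c : S) : L2 S →L[ℝ] L2 S :=
  weightedComp (fun _ => 1) (fun z => z + c) 1 (by simp) (add_left_injective c).injOn

@[simp]
theorem shift_apply (c : S) (f : L2 S) (z : S) : shift c f z = f (z + c) := by
  simp [shift]

theorem norm_shift_le (c : S) : ‖shift c‖ ≤ 1 := by
  refine (norm_weightedComp_le _ _).trans ?_
  simp

theorem shift_zero : shift (0 : S) = 1 := by
  ext f z; simp

theorem inner_shift_left (c : S) (f g : L2 S) :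
    inner ℝ (shift c f) g = inner ℝ f (shift (-c) g) := by
  refine (hasSum_mul _ _).unique ?_
  rw [← (Equiv.addRight c).symm.hasSum_iff]
  refine (hasSum_mul f (shift (-c) g)).congr_fun fun z => ?_
  simp

theorem inner_shift_le (c : S) (f : L2 S) : inner ℝ f (shift c f) ≤ ‖f‖ ^ 2 := by
  refine (real_inner_le_norm _ _).trans ?_
  rw [sq]
  gcongr
  simpa using (shift c).le_of_opNorm_le (norm_shift_le c) f

end Shift

theorem inner_mulOp_left {V : S → ℝ} {C : ℝ} (hV : ∀ z, |V z| ≤ C) (f g : L2 S) :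
    inner ℝ (mulOp V C hV f) g = inner ℝ f (mulOp V C hV g) := by
  refine (hasSum_mul _ _).unique ((hasSum_mul _ _).congr_fun fun z => ?_)
  simp [mul_left_comm, mul_assoc]

/-- An operator that maps non-negative functions to non-negative functions. -/
def IsPositivityPreserving (T : L2 S →L[ℝ] L2 S) : Prop :=
  ∀ f : L2 S, (∀ z, 0 ≤ f z) → ∀ z, 0 ≤ T f z

namespace IsPositivityPreserving

theorem one : IsPositivityPreserving (1 : L2 S →L[ℝ] L2 S) := fun _ hf => hf

theorem add {A B : L2 S →L[ℝ] L2 S} (hA : IsPositivityPreserving A)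
    (hB : IsPositivityPreserving B) : IsPositivityPreserving (A + B) :=
  fun f hf z => by simpa using add_nonneg (hA f hf z) (hB f hf z)

theorem smul {A : L2 S →L[ℝ] L2 S} (hA : IsPositivityPreserving A) {c : ℝ} (hc : 0 ≤ c) :
    IsPositivityPreserving (c • A) :=
  fun f hf z => by simpa using mul_nonneg hc (hA f hf z)

theorem sum {ι : Type*} (s : Finset ι) {A : ι → L2 S →L[ℝ] L2 S}
    (hA : ∀ i ∈ s, IsPositivityPreserving (A i)) : IsPositivityPreserving (∑ i ∈ s, A i) := by
  intro f hf z
  have : (∑ i ∈ s, A i) f z = ∑ i ∈ s, A i f z := by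
    rw [_root_.sum_apply, L2.sum_apply]
  rw [this]
  exact Finset.sum_nonneg fun i hi => hA i hi f hf z

theorem pow {A : L2 S →L[ℝ] L2 S} (hA : IsPositivityPreserving A) (k : ℕ) :
    IsPositivityPreserving (A ^ k) := by
  induction k with
  | zero => exact one
  | succ k ih =>
    intro f hf z
    rw [pow_succ']
    exact hA _ (ih f hf) z

theorem exp {A : L2 S →L[ℝ] L2 S} (hA : IsPositivityPreserving A) :
    IsPositivityPreserving (NormedSpace.exp A) := fun f hf z =>
  (hasSum_exp_apply A f z).nonneg fun k => mul_nonneg (by positivity) (hA.pow k f hf z)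

/-- All terms of the exponential series are nonnegative; only the linear one is kept. -/
theorem apply_le_exp_apply {A : L2 S →L[ℝ] L2 S} (hA : IsPositivityPreserving A) {f : L2 S}
    (hf : ∀ z, 0 ≤ f z) (z : S) : A f z ≤ NormedSpace.exp A f z := by
  simpa using le_hasSum (hasSum_exp_apply A f z) 1
    fun k _ => mul_nonneg (by positivity) (hA.pow k f hf z)

theorem shift [AddCommGroup S] (c : S) : IsPositivityPreserving (shift c) :=
  fun f hf z => by simpa using hf (z + c)

end IsPositivityPreserving

/-- The unit vector at a point. -/
def delta [DecidableEq S] (z : S) : L2 S := lp.single 2 z (1 : ℝ)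

section Delta

variable [DecidableEq S]

theorem delta_apply (z w : S) : delta z w = if w = z then 1 else 0 := by
  simp [delta, Pi.single_apply]

theorem delta_nonneg (z w : S) : 0 ≤ delta z w := by
  rw [delta_apply]; split_ifs <;> norm_num

theorem norm_delta (z : S) : ‖delta z‖ = 1 := by
  simp [delta, lp.norm_single]

theorem inner_delta_left (z : S) (f : L2 S) : inner ℝ (delta z) f = f z := by
  simp [delta, lp.inner_single_left]

/-- The restriction of a function to a finite set. -/
def truncate (s : Finset S) (f : L2 S) : L2 S := ∑ z ∈ s, f z • delta z

theorem truncate_apply (s : Finset S) (f : L2 S) (z : S) :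
    truncate s f z = if z ∈ s then f z else 0 := by
  rw [truncate, sum_apply]
  simp [delta_apply]

theorem tendsto_truncate (f : L2 S) : Tendsto (fun s => truncate s f) atTop (𝓝 f) := by
  have h := lp.hasSum_single (E := fun _ : S => ℝ) (p := 2) (by simp) f
  refine Tendsto.congr (fun s => ?_) h
  refine Finset.sum_congr rfl fun z _ => ?_
  ext w
  simp [delta_apply, Pi.single_apply]

theorem apply_eq_inner (T : L2 S →L[ℝ] L2 S) (z w : S) :
    T (delta w) z = inner ℝ (delta z) (T (delta w)) := (inner_delta_left _ _).symm

end Delta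

end L2

end

/-! ### The contact Hamiltonian and its heat kernel -/

noncomputable section

/-- Positions in `ℤ^d` of a family of particles. -/
abbrev Conf (I : Type*) (d : ℕ) := I → Fin d → ℤ

section Hamiltonian

open L2

variable {I : Type*} {d : ℕ}

/-- The configuration in which particle `ι` is at the unit vector `e_i` and all others at `0`. -/
def unitStep [DecidableEq I] (ι : I) (i : Fin d) : Conf I d := Pi.single ι (Pi.single i 1)

variable [Fintype I]

/-- The number of pairs of particles of different colours that sit at the same site. -/
def contacts (col : I → Bool) (z : Conf I d) : ℝ :=
  ∑ j, ∑ k, if col j = true ∧ col k = false ∧ z j = z k then 1 else 0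

theorem contacts_nonneg (col : I → Bool) (z : Conf I d) : 0 ≤ contacts col z :=
  Finset.sum_nonneg fun _ _ => Finset.sum_nonneg fun _ _ => by split_ifs <;> norm_num

theorem contacts_le (col : I → Bool) (z : Conf I d) :
    contacts col z ≤ contacts col (0 : Conf I d) := by
  refine Finset.sum_le_sum fun j _ => Finset.sum_le_sum fun k _ => ?_
  by_cases h : col j = true ∧ col k = false
  · simp only [h.1, h.2, true_and, Pi.zero_apply, if_true]
    split_ifs <;> norm_num
  · rw [if_neg (by tauto), if_neg (by tauto)]

theorem abs_contacts_le (col : I → Bool) (z : Conf I d) :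
    |contacts col z| ≤ contacts col (0 : Conf I d) := by
  rw [abs_of_nonneg (contacts_nonneg col z)]; exact contacts_le col z

theorem contacts_not (col : I → Bool) (z : Conf I d) :
    contacts (fun i => !col i) z = contacts col z := by
  unfold contacts
  rw [Finset.sum_comm]
  refine Finset.sum_congr rfl fun j _ => Finset.sum_congr rfl fun k _ => ?_
  simp only [Bool.not_eq_true', Bool.not_eq_false', eq_comm (a := z k)]
  congr 1
  exact propext ⟨fun h => ⟨h.2.1, h.1, h.2.2⟩, fun h => ⟨h.2.1, h.1, h.2.2⟩⟩

variable [DecidableEq I]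

/-- The discrete Laplacian acting on the position of particle `ι`. -/
def laplacian (ι : I) : L2 (Conf I d) →L[ℝ] L2 (Conf I d) :=
  ∑ i : Fin d, (shift (unitStep ι i) + shift (-unitStep ι i) - (2 : ℝ) • 1)

/-- Multiplication by the number of contacts. -/
def contactOp (col : I → Bool) : L2 (Conf I d) →L[ℝ] L2 (Conf I d) :=
  mulOp (contacts col) (contacts col 0) (abs_contacts_le col)

/-- The generator of the Feynman-Kac semigroup of independent walks with rates `r`, with the
number of contacts as potential. -/
def hamiltonian (col : I → Bool) (r : I → ℝ≥0) : L2 (Conf I d) →L[ℝ] L2 (Conf I d) :=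
  ∑ ι, (r ι : ℝ) • laplacian ι + contactOp col

theorem inner_laplacian (ι : I) (f g : L2 (Conf I d)) :
    inner ℝ f (laplacian ι g) = ∑ i : Fin d, (inner ℝ f (shift (unitStep ι i) g) +
      inner ℝ f (shift (-unitStep ι i) g) - 2 * inner ℝ f g) := by
  rw [laplacian, _root_.sum_apply, inner_sum]
  simp [inner_add_right, inner_sub_right, inner_smul_right]

theorem inner_laplacian_nonpos (ι : I) (f : L2 (Conf I d)) : inner ℝ f (laplacian ι f) ≤ 0 := by
  rw [inner_laplacian]
  refine Finset.sum_nonpos fun i _ => ?_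
  rw [real_inner_self_eq_norm_sq]
  linarith [inner_shift_le (unitStep ι i) f, inner_shift_le (-unitStep ι i) f]

theorem inner_laplacian_left (ι : I) (f g : L2 (Conf I d)) :
    inner ℝ (laplacian ι f) g = inner ℝ f (laplacian ι g) := by
  rw [real_inner_comm, inner_laplacian, inner_laplacian]
  refine Finset.sum_congr rfl fun i _ => ?_
  have h1 := inner_shift_left (unitStep ι i) f g
  have h2 := inner_shift_left (-unitStep ι i) f g
  rw [neg_neg] at h2
  rw [real_inner_comm (shift (unitStep ι i) f) g, real_inner_comm (shift (-unitStep ι i) f) g,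
    real_inner_comm f g, h1, h2]
  ring

theorem inner_hamiltonian (col : I → Bool) (r : I → ℝ≥0) (f g : L2 (Conf I d)) :
    inner ℝ f (hamiltonian col r g) =
      ∑ ι, (r ι : ℝ) * inner ℝ f (laplacian ι g) + inner ℝ f (contactOp col g) := by
  simp [hamiltonian, _root_.sum_apply, inner_sum, inner_add_right, inner_smul_right]

theorem inner_hamiltonian_left (col : I → Bool) (r : I → ℝ≥0) (f g : L2 (Conf I d)) :
    inner ℝ (hamiltonian col r f) g = inner ℝ f (hamiltonian col r g) := by
  rw [real_inner_comm, inner_hamiltonian, inner_hamiltonian]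
  congr 1
  · refine Finset.sum_congr rfl fun ι _ => ?_
    rw [← inner_laplacian_left, real_inner_comm]
  · rw [real_inner_comm]
    exact inner_mulOp_left _ _ _

/-- The top of the spectrum of the Hamiltonian. -/
def topEnergy (d : ℕ) (col : I → Bool) (r : I → ℝ≥0) : ℝ :=
  ⨆ f : {f : L2 (Conf I d) // ‖f‖ = 1}, inner ℝ f.1 (hamiltonian col r f.1)

theorem bddAbove_energy (col : I → Bool) (r : I → ℝ≥0) :
    BddAbove (Set.range fun f : {f : L2 (Conf I d) // ‖f‖ = 1} =>
      inner ℝ f.1 (hamiltonian col r f.1)) := by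
  refine ⟨‖hamiltonian (d := d) col r‖, ?_⟩
  rintro _ ⟨f, rfl⟩
  refine (real_inner_le_norm _ _).trans ?_
  simpa [f.2] using (hamiltonian col r).le_opNorm f.1

instance : Nonempty {f : L2 (Conf I d) // ‖f‖ = 1} := ⟨⟨delta 0, norm_delta 0⟩⟩

theorem inner_hamiltonian_le (col : I → Bool) (r : I → ℝ≥0) (f : L2 (Conf I d)) :
    inner ℝ f (hamiltonian col r f) ≤ topEnergy d col r * ‖f‖ ^ 2 := by
  rcases eq_or_ne f 0 with rfl | hf
  · simp
  have hf' : ‖f‖ ≠ 0 := norm_ne_zero_iff.2 hf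
  have h := le_ciSup (bddAbove_energy col r) ⟨‖f‖⁻¹ • f, by
    rw [norm_smul, norm_inv, norm_norm, inv_mul_cancel₀ hf']⟩
  simp only [map_smul, inner_smul_left, inner_smul_right] at h
  have hpos : 0 < ‖f‖ ^ 2 := by positivity
  have e : inner ℝ f (hamiltonian col r f) =
      (‖f‖⁻¹ * (‖f‖⁻¹ * inner ℝ f (hamiltonian col r f))) * ‖f‖ ^ 2 := by
    field_simp
  rw [e]
  exact mul_le_mul_of_nonneg_right h hpos.le

theorem topEnergy_le_iff (col : I → Bool) (r : I → ℝ≥0) (ν : ℝ) :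
    topEnergy d col r ≤ ν ↔
      ∀ f : L2 (Conf I d), inner ℝ f (hamiltonian col r f) ≤ ν * ‖f‖ ^ 2 := by
  refine ⟨fun h f => (inner_hamiltonian_le col r f).trans (by gcongr),
    fun h => ciSup_le fun f => ?_⟩
  simpa [f.2] using h f.1

/-! ### The kernel of the semigroup -/

/-- The integral kernel of the semigroup generated by the Hamiltonian. -/
def kernelFK (col : I → Bool) (r : I → ℝ≥0) (t : ℝ) (z w : Conf I d) : ℝ :=
  NormedSpace.exp (t • hamiltonian col r) (delta w) z

variable (col : I → Bool) (r : I → ℝ≥0)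

theorem kernelFK_eq_inner (t : ℝ) (z w : Conf I d) :
    kernelFK col r t z w = inner ℝ (delta z) (NormedSpace.exp (t • hamiltonian col r) (delta w)) :=
  apply_eq_inner _ _ _

/-- Cauchy-Schwarz with unit vectors, since the semigroup has norm at most exp(tE). -/
theorem kernelFK_le {t : ℝ} (ht : 0 ≤ t) (z w : Conf I d) :
    kernelFK col r t z w ≤ Real.exp (t * topEnergy d col r) := by
  rw [kernelFK_eq_inner]
  refine (real_inner_le_norm _ _).trans ?_
  rw [norm_delta, one_mul]
  simpa [norm_delta] using norm_exp_smul_apply_le (inner_hamiltonian_le col r) ht (delta w)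

theorem kernelFK_symm (t : ℝ) (z w : Conf I d) : kernelFK col r t z w = kernelFK col r t w z := by
  rw [kernelFK_eq_inner, ← inner_exp_smul_comm (inner_hamiltonian_left col r), real_inner_comm,
    kernelFK_eq_inner]

/-- Adding a multiple of the identity to the Hamiltonian makes its matrix non-negative. -/
theorem hamiltonian_add_eq : hamiltonian (d := d) col r + (∑ ι, (r ι : ℝ) * (2 * d)) • 1 =
    ∑ ι, (r ι : ℝ) • ∑ i : Fin d, (shift (unitStep ι i) + shift (-unitStep ι i)) +
      contactOp col := by
  have : ∀ ι : I, laplacian (d := d) ι =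
      ∑ i : Fin d, (shift (unitStep ι i) + shift (-unitStep ι i)) - ((2 * d : ℝ)) • 1 := by
    intro ι
    rw [laplacian, Finset.sum_sub_distrib]
    congr 1
    rw [Finset.sum_const, Finset.card_univ, Fintype.card_fin, ← Nat.cast_smul_eq_nsmul ℝ, smul_smul,
      mul_comm]
  simp only [hamiltonian, this, smul_sub, Finset.sum_sub_distrib, smul_smul, ← Finset.sum_smul]
  abel

theorem isPositivityPreserving_hamiltonian_add :
    IsPositivityPreserving (hamiltonian (d := d) col r + (∑ ι, (r ι : ℝ) * (2 * d)) • 1) := by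
  rw [hamiltonian_add_eq]
  refine (IsPositivityPreserving.sum _ fun ι _ => ?_).add ?_
  · exact (IsPositivityPreserving.sum _ fun i _ => (IsPositivityPreserving.shift _).add
      (IsPositivityPreserving.shift _)).smul (r ι).2
  · intro f hf z
    exact mul_nonneg (contacts_nonneg col z) (hf z)

theorem exp_hamiltonian_eq (t : ℝ) : NormedSpace.exp (t • hamiltonian (d := d) col r) =
    Real.exp (-(t * ∑ ι, (r ι : ℝ) * (2 * d))) •
      NormedSpace.exp (t • (hamiltonian col r + (∑ ι, (r ι : ℝ) * (2 * d)) • 1)) := by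
  rw [← exp_smul_sub_smul_one, add_sub_cancel_right]

/-- The negative diagonal of the Laplacians is a multiple of the identity. Removing it only rescales
the semigroup and leaves the exponential series of an operator with nonnegative entries. -/
theorem isPositivityPreserving_exp_hamiltonian {t : ℝ} (ht : 0 ≤ t) :
    IsPositivityPreserving (NormedSpace.exp (t • hamiltonian (d := d) col r)) := by
  rw [exp_hamiltonian_eq]
  exact ((isPositivityPreserving_hamiltonian_add col r).smul ht).exp.smul (Real.exp_pos _).le

theorem kernelFK_nonneg {t : ℝ} (ht : 0 ≤ t) (z w : Conf I d) : 0 ≤ kernelFK col r t z w :=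
  isPositivityPreserving_exp_hamiltonian col r ht _ (delta_nonneg w) z

/-- One term of the Chapman-Kolmogorov sum: pointwise exp(tH)δ_c is at least its value at `b` times
δ_b, and exp(sH) preserves this inequality. -/
theorem kernelFK_mul_le {s t : ℝ} (hs : 0 ≤ s) (ht : 0 ≤ t) (a b c : Conf I d) :
    kernelFK col r s a b * kernelFK col r t b c ≤ kernelFK col r (s + t) a c := by
  have h := isPositivityPreserving_exp_hamiltonian col r hs
    (NormedSpace.exp (t • hamiltonian col r) (delta c) - kernelFK col r t b c • delta b) (by
      intro z
      simp only [lp.coeFn_sub, Pi.sub_apply, lp.coeFn_smul, Pi.smul_apply, delta_apply, smul_eq_mul]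
      split_ifs with hz
      · subst hz; simp [kernelFK]
      · simpa using isPositivityPreserving_exp_hamiltonian col r ht _ (delta_nonneg c) z) a
  rw [map_sub, map_smul, ← exp_add_smul_apply] at h
  simp only [lp.coeFn_sub, Pi.sub_apply, lp.coeFn_smul, Pi.smul_apply, smul_eq_mul] at h
  unfold kernelFK at h ⊢
  linarith

theorem kernelFK_self_pos {t : ℝ} (ht : 0 ≤ t) (z : Conf I d) : 0 < kernelFK col r t z z := by
  rw [kernelFK_eq_inner]
  exact (Real.exp_pos _).trans_le
    (exp_inner_le_inner_exp (inner_hamiltonian_left col r) (norm_delta z) ht)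

theorem kernelFK_step_pos {t : ℝ} (ht : 0 < t) {ι : I} (hι : r ι ≠ 0) (i : Fin d) {c : Conf I d}
    (hc : c = unitStep ι i ∨ c = -unitStep ι i) (z : Conf I d) :
    0 < kernelFK col r t z (z + c) := by
  have hpp := (isPositivityPreserving_hamiltonian_add (d := d) col r).smul ht.le
  rw [kernelFK, exp_hamiltonian_eq, smul_apply, lp.coeFn_smul, Pi.smul_apply, smul_eq_mul]
  refine mul_pos (Real.exp_pos _) (lt_of_lt_of_le ?_ (hpp.apply_le_exp_apply (delta_nonneg _) z))
  rw [smul_apply, lp.coeFn_smul, Pi.smul_apply, smul_eq_mul, hamiltonian_add_eq]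
  refine mul_pos ht ?_
  have hr : (0 : ℝ) < r ι := by positivity
  simp only [add_apply, _root_.sum_apply, lp.coeFn_add, Pi.add_apply, L2.sum_apply, smul_apply,
    lp.coeFn_smul, Pi.smul_apply, smul_eq_mul, shift_apply]
  have hV : 0 ≤ contactOp col (delta (z + c)) z :=
    mul_nonneg (contacts_nonneg col z) (delta_nonneg _ z)
  refine add_pos_of_pos_of_nonneg (Finset.sum_pos' (fun ι' _ => mul_nonneg (r ι').2
    (Finset.sum_nonneg fun i' _ => add_nonneg (delta_nonneg _ _) (delta_nonneg _ _)))
    ⟨ι, Finset.mem_univ _, mul_pos hr (Finset.sum_pos' (fun i' _ => add_nonneg (delta_nonneg _ _)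
      (delta_nonneg _ _)) ⟨i, Finset.mem_univ _, ?_⟩)⟩) hV
  rcases hc with rfl | rfl
  · exact add_pos_of_pos_of_nonneg (by simp [delta_apply]) (delta_nonneg _ _)
  · exact add_pos_of_nonneg_of_pos (delta_nonneg _ _) (by simp [delta_apply])

/-- The displacements that the walks can make in every positive time. -/
def reachable (d : ℕ) : AddSubmonoid (Conf I d) where
  carrier := {c | ∀ (z : Conf I d) (t : ℝ), 0 < t → 0 < kernelFK col r t z (z + c)}
  zero_mem' := fun z t ht => by simpa using kernelFK_self_pos col r ht.le z
  add_mem' := fun {a b} ha hb z t ht => by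
    have h := kernelFK_mul_le col r (half_pos ht).le (half_pos ht).le z (z + a) (z + a + b)
    rw [add_halves, add_assoc z a b] at h
    refine (mul_pos (ha z _ (half_pos ht)) ?_).trans_le h
    rw [← add_assoc]
    exact hb (z + a) _ (half_pos ht)

/-- Such a displacement is a sum of unit steps of moving particles. Single steps have positive
kernel at every positive time, and splitting the time in halves makes this property additive. -/
theorem mem_reachable {c : Conf I d} (hc : ∀ ι, r ι = 0 → c ι = 0) : c ∈ reachable col r d := by
  have e : c = ∑ ι, ∑ i, c ι i • unitStep ι i := by
    ext ι i
    simp only [unitStep, Finset.sum_apply, Pi.smul_apply, Pi.single_apply, smul_eq_mul]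
    rw [Finset.sum_eq_single ι (by intros; simp_all [eq_comm]) (by simp)]
    simp [Pi.single_apply]
  rw [e]
  refine sum_mem fun ι _ => sum_mem fun i _ => ?_
  by_cases hι : r ι = 0
  · simp [hc ι hι, zero_mem]
  · obtain ⟨k, hk | hk⟩ := (c ι i).eq_nat_or_neg
    · rw [hk, natCast_zsmul]
      exact nsmul_mem (show unitStep ι i ∈ reachable col r d from
        fun z t ht => kernelFK_step_pos col r ht hι i (Or.inl rfl) z) k
    · rw [hk, neg_smul, natCast_zsmul, ← smul_neg]
      exact nsmul_mem (show -unitStep ι i ∈ reachable col r d from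
        fun z t ht => kernelFK_step_pos col r ht hι i (Or.inr rfl) z) k

theorem kernelFK_pos {z w : Conf I d} (h : ∀ ι, r ι = 0 → w ι = z ι) {t : ℝ} (ht : 0 < t) :
    0 < kernelFK col r t z w := by
  have := mem_reachable col r (c := w - z) (fun ι hι => by simp [h ι hι]) z t ht
  simpa using this

/-- The return kernel grows at least as fast as the energy of a finitely supported function whose
support can be reached. -/
theorem exists_mul_exp_le_kernelFK (z : Conf I d) (s : Finset (Conf I d))
    (hs : ∀ w ∈ s, ∀ ι, r ι = 0 → w ι = z ι) {f : L2 (Conf I d)} (hf : ‖f‖ = 1)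
    (hfs : truncate s f = f) :
    ∃ C > 0, ∀ t : ℝ, 2 ≤ t →
      C * Real.exp (t * inner ℝ f (hamiltonian col r f)) ≤ kernelFK col r t z z := by
  set R := inner ℝ f (hamiltonian col r f)
  set B : ℝ := ∑ a ∈ s, ∑ b ∈ s, |f a| * |f b| / (kernelFK col r 1 z a * kernelFK col r 1 b z)
  have hp1 : ∀ a ∈ s, 0 < kernelFK col r 1 z a := fun a ha =>
    kernelFK_pos col r (hs a ha) one_pos
  have hp2 : ∀ a ∈ s, 0 < kernelFK col r 1 a z := fun a ha => by
    rw [kernelFK_symm]; exact hp1 a ha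
  have hB0 : 0 ≤ B := Finset.sum_nonneg fun a ha => Finset.sum_nonneg fun b hb =>
    div_nonneg (by positivity) (mul_pos (hp1 a ha) (hp2 b hb)).le
  -- One unit of time is spent going from `z` to the support of `f` and one returning, so Jensen's
  -- inequality is applied at time `t - 2`; this costs exp(-2R). The added 1 keeps the denominator
  -- positive.
  refine ⟨Real.exp (-(2 * R)) / (B + 1), by positivity, fun t ht => ?_⟩
  have h2 : 0 ≤ t - 2 := by linarith
  have hJ := exp_inner_le_inner_exp (inner_hamiltonian_left col r) hf h2
  have hexp : inner ℝ f (NormedSpace.exp ((t - 2) • hamiltonian col r) f) =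
      ∑ a ∈ s, ∑ b ∈ s, f a * f b * kernelFK col r (t - 2) a b := by
    conv_lhs => rw [← hfs]
    rw [truncate, map_sum, sum_inner]
    refine Finset.sum_congr rfl fun a _ => ?_
    rw [inner_sum]
    refine Finset.sum_congr rfl fun b _ => ?_
    rw [map_smul, inner_smul_left, inner_smul_right, kernelFK_eq_inner]
    simp [mul_assoc]
  have hle : ∑ a ∈ s, ∑ b ∈ s, f a * f b * kernelFK col r (t - 2) a b ≤
      B * kernelFK col r t z z := by
    simp only [B, Finset.sum_mul]
    refine Finset.sum_le_sum fun a ha => Finset.sum_le_sum fun b hb => ?_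
    have hab := kernelFK_nonneg col r h2 a b
    have h3 := kernelFK_mul_le col r zero_le_one h2 z a b
    have h4 := kernelFK_mul_le col r (by linarith : (0 : ℝ) ≤ 1 + (t - 2)) zero_le_one z b z
    have e : (1 : ℝ) + (t - 2) + 1 = t := by ring
    rw [e] at h4
    have h5 : kernelFK col r 1 z a * kernelFK col r (t - 2) a b * kernelFK col r 1 b z ≤
        kernelFK col r t z z := (mul_le_mul_of_nonneg_right h3 (hp2 b hb).le).trans h4
    calc f a * f b * kernelFK col r (t - 2) a b
        ≤ |f a| * |f b| * kernelFK col r (t - 2) a b := by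
          rw [← abs_mul]
          exact mul_le_mul_of_nonneg_right (le_abs_self _) hab
      _ ≤ |f a| * |f b| *
          (kernelFK col r t z z / (kernelFK col r 1 z a * kernelFK col r 1 b z)) := by
          gcongr
          rw [le_div_iff₀ (mul_pos (hp1 a ha) (hp2 b hb))]
          linarith
      _ = _ := by ring
  have hk := kernelFK_nonneg col r (by linarith : (0 : ℝ) ≤ t) z z
  rw [div_mul_eq_mul_div, div_le_iff₀ (by positivity), ← Real.exp_add]
  have e : -(2 * R) + t * R = (t - 2) * R := by ring
  rw [e]
  nlinarith [hexp ▸ hJ]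

end Hamiltonian

end

/-! ### Frozen particles: reduction to a common site -/

noncomputable section

section Frozen

open L2

variable {I : Type*} [Fintype I] [DecidableEq I] {d : ℕ}

/-- Assembles a configuration from the positions `y` of the particles of colour `false`, and the
positions `u` of the others as seen from `k`, where `k` is seen at `v`. -/
def frozenEquiv (col : I → Bool) (v : Fin d → ℤ) (k : {i // col i = false}) :
    (({i // col i = false} → Fin d → ℤ) × ({i // ¬ col i = false} → Fin d → ℤ)) ≃ Conf I d where
  toFun x := fun ι => if h : col ι = false then x.1 ⟨ι, h⟩ else x.2 ⟨ι, h⟩ + (x.1 k - v)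
  invFun z := (fun i => z i, fun i => z i - (z k - v))
  left_inv x := by
    refine Prod.ext ?_ ?_
    · funext i
      simp [i.2]
    · funext i
      have := i.2
      simp only [k.2, i.2, dif_pos]
      simp
  right_inv z := by
    funext ι
    by_cases h : col ι = false <;> simp [h]

/-- Moves a configuration with particles of colour `false` at `v` to the one with these particles
at `y`, keeping the positions of the others relative to `k`. -/
def unfreeze (col : I → Bool) (v : Fin d → ℤ) (k : {i // col i = false})
    (y : {i // col i = false} → Fin d → ℤ) (z : Conf I d) : Conf I d :=
  frozenEquiv col v k (y, fun i => z i)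

theorem unfreeze_apply (col : I → Bool) (v : Fin d → ℤ) (k : {i // col i = false})
    (y : {i // col i = false} → Fin d → ℤ) (z : Conf I d) (ι : I) :
    unfreeze col v k y z ι = if h : col ι = false then y ⟨ι, h⟩ else z ι + (y k - v) := rfl

/-- The indicator of the configurations with all particles of colour `false` at `v`. -/
def frozenIndicator (col : I → Bool) (v : Fin d → ℤ) (z : Conf I d) : ℝ :=
  if ∀ ι, col ι = false → z ι = v then 1 else 0

theorem abs_frozenIndicator_le (col : I → Bool) (v : Fin d → ℤ) (z : Conf I d) :
    |frozenIndicator col v z| ≤ 1 := by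
  unfold frozenIndicator; split_ifs <;> simp

theorem frozenIndicator_ne_zero {col : I → Bool} {v : Fin d → ℤ} {z : Conf I d} :
    frozenIndicator col v z ≠ 0 ↔ ∀ ι, col ι = false → z ι = v := by
  simp [frozenIndicator]

theorem injOn_unfreeze (col : I → Bool) (v : Fin d → ℤ) (k : {i // col i = false})
    (y : {i // col i = false} → Fin d → ℤ) :
    Set.InjOn (unfreeze col v k y) {z | frozenIndicator col v z ≠ 0} := by
  intro z hz z' hz' h
  rw [Set.mem_ofPred_eq, frozenIndicator_ne_zero] at hz hz'
  funext ι
  by_cases hι : col ι = false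
  · rw [hz ι hι, hz' ι hι]
  · simpa [unfreeze_apply, hι] using congrFun h ι

/-- The slice of `f` at the positions `y` of the particles of colour `false`, transported to the
configurations with these particles at `v`. -/
def slice (col : I → Bool) (v : Fin d → ℤ) (k : {i // col i = false})
    (y : {i // col i = false} → Fin d → ℤ) : L2 (Conf I d) →L[ℝ] L2 (Conf I d) :=
  weightedComp (frozenIndicator col v) (unfreeze col v k y) 1 (abs_frozenIndicator_le col v)
    (injOn_unfreeze col v k y)

variable {col : I → Bool} {v : Fin d → ℤ} {k : {i // col i = false}}

theorem slice_apply (y : {i // col i = false} → Fin d → ℤ) (f : L2 (Conf I d)) (z : Conf I d) :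
    slice col v k y f z = frozenIndicator col v z * f (unfreeze col v k y z) := rfl

/-- Fubini in the coordinates of `frozenEquiv`: the slices decompose inner products, and in
particular ‖f‖², over the positions of the frozen particles. -/
theorem hasSum_inner_slice (f g : L2 (Conf I d)) :
    HasSum (fun y => inner ℝ (slice col v k y f) (slice col v k y g)) (inner ℝ f g) := by
  have h := (frozenEquiv col v k).hasSum_iff.2 (hasSum_mul f g)
  refine h.prod_fiberwise fun y => ?_
  set base : ({i // ¬ col i = false} → Fin d → ℤ) → Conf I d :=
    fun u ι => if h : col ι = false then v else u ⟨ι, h⟩ with hbase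
  have hinj : Function.Injective base := by
    intro u u' huu
    funext i
    simpa [hbase, i.2] using congrFun huu i
  -- A configuration outside the range of `base` has a particle of colour `false` away from `v`,
  -- where slices vanish.
  have h2 := (hinj.hasSum_iff (f := fun z => slice col v k y f z * slice col v k y g z) (by
    intro z hz
    have : ¬ frozenIndicator col v z ≠ 0 := by
      rw [frozenIndicator_ne_zero]
      intro hz'
      refine hz ⟨fun i => z i, funext fun ι => ?_⟩
      by_cases hι : col ι = false
      · simp [hbase, hι, hz' ι hι]
      · simp [hbase, hι]
    simp [slice_apply, not_not.1 this])).2 (hasSum_mul _ _)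
  refine h2.congr_fun fun u => ?_
  have hone : frozenIndicator col v (base u) = 1 := by
    rw [frozenIndicator, if_pos]
    intro ι hι
    simp [hbase, hι]
  have hun : unfreeze col v k y (base u) = frozenEquiv col v k (y, u) := by
    unfold unfreeze
    congr 2
    funext i
    simp [hbase, i.2]
  simp only [Function.comp, slice_apply, hone, hun, one_mul]

theorem shift_slice (y : {i // col i = false} → Fin d → ℤ) {c : Conf I d}
    (hc : ∀ ι, col ι = false → c ι = 0) (f : L2 (Conf I d)) :
    shift c (slice col v k y f) = slice col v k y (shift c f) := by
  ext z
  have h1 : frozenIndicator col v (z + c) = frozenIndicator col v z := by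
    unfold frozenIndicator
    congr 1
    refine propext (forall_congr' fun ι => forall_congr' fun hι => ?_)
    simp [hc ι hι]
  have h2 : unfreeze col v k y (z + c) = unfreeze col v k y z + c := by
    funext ι
    rw [Pi.add_apply, unfreeze_apply, unfreeze_apply]
    split_ifs with hι
    · simp [hc ι hι]
    · simp only [Pi.add_apply]; abel
  rw [shift_apply, slice_apply, slice_apply, shift_apply, h1, h2]

/-- A slice only translates the particles of colour `true` as a block, and this commutes with moving
one of them. -/
theorem laplacian_slice (y : {i // col i = false} → Fin d → ℤ) {ι : I} (hι : col ι ≠ false)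
    (f : L2 (Conf I d)) :
    laplacian ι (slice col v k y f) = slice col v k y (laplacian ι f) := by
  have hc : ∀ i : Fin d, ∀ ι', col ι' = false → unitStep ι i ι' = 0 := by
    intro i ι' hι'
    rw [unitStep, Pi.single_eq_of_ne]
    rintro rfl
    exact hι hι'
  simp only [laplacian, _root_.sum_apply, map_sum, sub_apply, add_apply, smul_apply,
    one_apply_eq_self, map_sub, map_add, map_smul]
  refine Finset.sum_congr rfl fun i _ => ?_
  rw [shift_slice y (hc i), shift_slice y (fun a ha => by simp [hc i a ha])]

/-- The number of particles of colour `true` at the site of `k`. -/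
def contactsWith (col : I → Bool) (k : I) (z : Conf I d) : ℝ :=
  ∑ j, if col j = true ∧ z j = z k then 1 else 0

theorem contactsWith_le (col : I → Bool) (k : I) (z : Conf I d) :
    |contactsWith col k z| ≤ Fintype.card I := by
  unfold contactsWith
  rw [abs_of_nonneg (Finset.sum_nonneg fun _ _ => by split_ifs <;> norm_num)]
  calc _ ≤ ∑ _j : I, (1 : ℝ) := Finset.sum_le_sum fun _ _ => by split_ifs <;> norm_num
    _ = _ := by simp

theorem contacts_eq_sum (col : I → Bool) (z : Conf I d) :
    contacts col z = ∑ k : {i // col i = false}, contactsWith col k z := by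
  unfold contacts contactsWith
  rw [Finset.sum_comm]
  rw [← Finset.sum_subtype (Finset.univ.filter fun i => col i = false) (by simp)
    (fun k => ∑ j, if col j = true ∧ z j = z k then (1 : ℝ) else 0), Finset.sum_filter]
  refine Finset.sum_congr rfl fun k _ => ?_
  split_ifs with hk <;> simp [hk]

/-- On a slice all particles of colour `false` sit at `v`, so each has the same contacts. Positions
are transported relative to `k`, so these are the contacts of `k` in the original configuration. -/
theorem contactOp_slice (y : {i // col i = false} → Fin d → ℤ) (f : L2 (Conf I d)) :
    contactOp col (slice col v k y f) = ((Fintype.card {i // col i = false} : ℕ) : ℝ) •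
      slice col v k y (mulOp (contactsWith col k) _ (contactsWith_le col k) f) := by
  ext z
  rw [lp.coeFn_smul, Pi.smul_apply, contactOp, mulOp_apply, slice_apply, slice_apply, mulOp_apply,
    smul_eq_mul]
  by_cases h : frozenIndicator col v z = 0
  · simp [h]
  have hz := frozenIndicator_ne_zero.1 h
  have e : ∀ k' : {i // col i = false},
      contactsWith col k' z = contactsWith col k (unfreeze col v k y z) := by
    intro k'
    unfold contactsWith
    refine Finset.sum_congr rfl fun j _ => ?_
    congr 1
    refine propext (and_congr_right fun hj => ?_)
    rw [unfreeze_apply, unfreeze_apply, dif_neg (by simp [hj]), dif_pos k.2, hz k' k'.2]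
    constructor
    · intro h; rw [h]; simp
    · intro h
      have h' : z j + (y k - v) = v + (y k - v) := by rw [h]; abel
      exact add_right_cancel h'
  rw [contacts_eq_sum, Finset.sum_congr rfl fun k' _ => e k']
  simp only [Finset.sum_const, Finset.card_univ, nsmul_eq_mul]
  ring

/-- If the particles of colour `false` do not move, the energy is largest when they are all at the
same site. -/
theorem inner_hamiltonian_le_of_frozen {r : I → ℝ≥0} (hr : ∀ ι, col ι = false → r ι = 0)
    (hne : ∃ ι, col ι = false) (v : Fin d → ℤ) {ν : ℝ}
    (h : ∀ g : L2 (Conf I d), (∀ z, g z ≠ 0 → ∀ ι, col ι = false → z ι = v) →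
      inner ℝ g (hamiltonian col r g) ≤ ν * ‖g‖ ^ 2) (f : L2 (Conf I d)) :
    inner ℝ f (hamiltonian col r f) ≤ ν * ‖f‖ ^ 2 := by
  set N : ℝ := ((Fintype.card {i // col i = false} : ℕ) : ℝ) with hN
  have hNpos : 0 < N := by
    obtain ⟨ι, hι⟩ := hne
    have : Nonempty {i // col i = false} := ⟨⟨ι, hι⟩⟩
    rw [hN]
    exact_mod_cast Fintype.card_pos
  set K : L2 (Conf I d) := ∑ ι, (r ι : ℝ) • laplacian ι f with hK
  have hH : ∀ (k : {i // col i = false}) y, hamiltonian col r (slice col v k y f) =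
      slice col v k y (K + N • mulOp (contactsWith col k) _ (contactsWith_le col k) f) := by
    intro k y
    simp only [hamiltonian, add_apply, _root_.sum_apply, smul_apply, map_add, map_smul, hK, map_sum]
    rw [contactOp_slice]
    congr 1
    refine Finset.sum_congr rfl fun ι _ => ?_
    by_cases hι : col ι = false
    · simp [hr ι hι]
    · rw [laplacian_slice y hι]
  -- Write V_k for the contacts with `k`. The operator K + N V_k acts on slices as the full
  -- Hamiltonian does with all frozen particles at `v`, where the hypothesis applies. Summing over
  -- the `N` choices of `k` gives `N` times the Hamiltonian, because ∑ V_k is the contact potential.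
  have hk : ∀ k : {i // col i = false},
      inner ℝ f (K + N • mulOp (contactsWith col k) _ (contactsWith_le col k) f) ≤ ν * ‖f‖ ^ 2 := by
    intro k
    have h1 := hasSum_inner_slice (v := v) (k := k) f
      (K + N • mulOp (contactsWith col k) _ (contactsWith_le col k) f)
    have h2 := (hasSum_inner_slice (v := v) (k := k) f f).mul_left ν
    rw [real_inner_self_eq_norm_sq] at h2
    refine hasSum_le (fun y => ?_) h1 h2
    rw [← hH, real_inner_self_eq_norm_sq]
    refine h _ fun z hz => frozenIndicator_ne_zero.1 ?_
    rw [slice_apply] at hz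
    exact left_ne_zero_of_mul hz
  have hsum : ∑ k : {i // col i = false},
      mulOp (contactsWith col k) _ (contactsWith_le col k) f = contactOp col f := by
    ext z
    rw [L2.sum_apply, contactOp, mulOp_apply, contacts_eq_sum, Finset.sum_mul]
    rfl
  have htot := Finset.sum_le_sum fun (k : {i // col i = false}) (_ : k ∈ Finset.univ) => hk k
  have hHf : inner ℝ f (hamiltonian col r f) = inner ℝ f K + inner ℝ f (contactOp col f) := by
    rw [← inner_add_right, hK, hamiltonian]
    simp [_root_.sum_apply]
  rw [← inner_sum, Finset.sum_add_distrib, ← Finset.smul_sum, hsum, Finset.sum_const,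
    Finset.sum_const, Finset.card_univ, nsmul_eq_mul, inner_add_right, inner_smul_right,
    ← Nat.cast_smul_eq_nsmul ℝ, inner_smul_right, ← hN, ← mul_add, ← hHf] at htot
  exact le_of_mul_le_mul_left htot hNpos

end Frozen

/-! ### Finitely supported test functions and growth of the return kernel -/

section Reachable

open L2

variable {I : Type*} [Fintype I] [DecidableEq I] {d : ℕ}

/-- The top energy is approached by functions of finite support within a class `A`, if it is
determined by functions supported in `A`. -/
theorem exists_finite_energy_gt (col : I → Bool) (r : I → ℝ≥0) (A : Set (Conf I d))
    (hA : ∀ ν : ℝ, (∀ g : L2 (Conf I d), (∀ z, g z ≠ 0 → z ∈ A) →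
      inner ℝ g (hamiltonian col r g) ≤ ν * ‖g‖ ^ 2) → topEnergy d col r ≤ ν)
    {ν : ℝ} (hν : ν < topEnergy d col r) :
    ∃ (f : L2 (Conf I d)) (s : Finset (Conf I d)), ‖f‖ = 1 ∧ truncate s f = f ∧
      (∀ w ∈ s, w ∈ A) ∧ ν < inner ℝ f (hamiltonian col r f) := by
  classical
  by_contra hcon
  push Not at hcon
  refine absurd (hA ν fun g hg => ?_) (not_le.2 hν)
  -- Truncations of `g` are still supported in `A` and converge to `g` in norm; the energy is
  -- continuous, so the bound passes to the limit.
  have hfin : ∀ s : Finset (Conf I d),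
      inner ℝ (truncate s g) (hamiltonian col r (truncate s g)) ≤ ν * ‖truncate s g‖ ^ 2 := by
    intro s
    rcases eq_or_ne (truncate s g) 0 with h0 | h0
    · simp [h0]
    have hn : ‖truncate s g‖ ≠ 0 := norm_ne_zero_iff.2 h0
    have := hcon (‖truncate s g‖⁻¹ • truncate s g) (s.filter (· ∈ A))
      (by rw [norm_smul, norm_inv, norm_norm, inv_mul_cancel₀ hn]) (by
        ext z
        rw [truncate_apply]
        simp only [lp.coeFn_smul, Pi.smul_apply, truncate_apply, Finset.mem_filter]
        by_cases hz : g z = 0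
        · simp [hz]
        · simp only [hg z hz, and_true]
          split_ifs <;> simp) (by simp)
    rw [map_smul, inner_smul_left, inner_smul_right] at this
    have hpos : 0 < ‖truncate s g‖ ^ 2 := by positivity
    have e : inner ℝ (truncate s g) (hamiltonian col r (truncate s g)) =
        (‖truncate s g‖⁻¹ * (‖truncate s g‖⁻¹ *
          inner ℝ (truncate s g) (hamiltonian col r (truncate s g)))) * ‖truncate s g‖ ^ 2 := by
      field_simp
    rw [e]
    exact mul_le_mul_of_nonneg_right this hpos.le
  have ht := tendsto_truncate g
  refine le_of_tendsto_of_tendsto' (ht.inner (((hamiltonian col r).continuous.tendsto g).comp ht))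
    ((ht.norm.pow 2).const_mul ν) hfin

/-- The return kernel of `z` grows at the rate given by the top energy, if the top energy is
determined by functions supported on what can be reached from `z`. -/
theorem exists_mul_exp_le_kernelFK_of_lt (col : I → Bool) (r : I → ℝ≥0) (z : Conf I d)
    (hz : ∀ ν : ℝ, (∀ g : L2 (Conf I d), (∀ w, g w ≠ 0 → ∀ ι, r ι = 0 → w ι = z ι) →
      inner ℝ g (hamiltonian col r g) ≤ ν * ‖g‖ ^ 2) → topEnergy d col r ≤ ν)
    {ν : ℝ} (hν : ν < topEnergy d col r) :
    ∃ C > 0, ∀ t : ℝ, 2 ≤ t → C * Real.exp (t * ν) ≤ kernelFK col r t z z := by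
  obtain ⟨f, s, hf, hfs, hsA, hlt⟩ := exists_finite_energy_gt col r
    {w | ∀ ι, r ι = 0 → w ι = z ι} hz hν
  obtain ⟨C, hC, h⟩ := exists_mul_exp_le_kernelFK col r z s hsA hf hfs
  refine ⟨C, hC, fun t ht => le_trans ?_ (h t ht)⟩
  gcongr

end Reachable

end

/-! ### The top energy as a function of the two rates -/

noncomputable section

section TwoRates

open L2

variable {d p n : ℕ}

/-- The rates of `p` particles with rate `κ` and `n` particles with rate `ρ`. -/
def twoRates (p n : ℕ) (κ ρ : ℝ≥0) : Fin p ⊕ Fin n → ℝ≥0 := Sum.elim (fun _ => κ) fun _ => ρ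

/-- The top energy of `p` particles with rate `κ` that interact with `n` particles with
rate `ρ`. -/
def twoRateEnergy (d p n : ℕ) (x : ℝ≥0 × ℝ≥0) : ℝ :=
  topEnergy d (Sum.isLeft : Fin p ⊕ Fin n → Bool) (twoRates p n x.1 x.2)

theorem inner_hamiltonian_twoRates (κ ρ : ℝ≥0) (f : L2 (Conf (Fin p ⊕ Fin n) d)) :
    inner ℝ f (hamiltonian Sum.isLeft (twoRates p n κ ρ) f) =
      κ * (∑ j : Fin p, inner ℝ f (laplacian (Sum.inl j) f)) +
      ρ * (∑ k : Fin n, inner ℝ f (laplacian (Sum.inr k) f)) +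
      inner ℝ f (contactOp Sum.isLeft f) := by
  rw [inner_hamiltonian, Fintype.sum_sum_type, Finset.mul_sum, Finset.mul_sum]
  rfl

/-- Displays the energy as a supremum of functions affine in the rates, from which monotonicity,
convexity and continuity are read off. -/
theorem twoRateEnergy_le_iff (x : ℝ≥0 × ℝ≥0) (ν : ℝ) : twoRateEnergy d p n x ≤ ν ↔
    ∀ f : L2 (Conf (Fin p ⊕ Fin n) d), ‖f‖ = 1 →
      x.1 * (∑ j : Fin p, inner ℝ f (laplacian (Sum.inl j) f)) +
      x.2 * (∑ k : Fin n, inner ℝ f (laplacian (Sum.inr k) f)) +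
      inner ℝ f (contactOp Sum.isLeft f) ≤ ν := by
  simp only [← inner_hamiltonian_twoRates]
  refine ⟨fun h f hf => ?_, fun h => ciSup_le fun f => h f.1 f.2⟩
  simpa [hf] using (topEnergy_le_iff _ _ _).1 h f

theorem le_twoRateEnergy (x : ℝ≥0 × ℝ≥0) {f : L2 (Conf (Fin p ⊕ Fin n) d)} (hf : ‖f‖ = 1) :
    x.1 * (∑ j : Fin p, inner ℝ f (laplacian (Sum.inl j) f)) +
      x.2 * (∑ k : Fin n, inner ℝ f (laplacian (Sum.inr k) f)) +
      inner ℝ f (contactOp Sum.isLeft f) ≤ twoRateEnergy d p n x :=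
  (twoRateEnergy_le_iff x _).1 le_rfl f hf

theorem twoRateEnergy_anti {x y : ℝ≥0 × ℝ≥0} (h : x ≤ y) :
    twoRateEnergy d p n y ≤ twoRateEnergy d p n x := by
  rw [twoRateEnergy_le_iff]
  intro f hf
  refine le_trans ?_ (le_twoRateEnergy x hf)
  have h1 : ∑ j : Fin p, inner ℝ f (laplacian (Sum.inl j) f) ≤ 0 :=
    Finset.sum_nonpos fun _ _ => inner_laplacian_nonpos _ _
  have h2 : ∑ k : Fin n, inner ℝ f (laplacian (Sum.inr k) f) ≤ 0 :=
    Finset.sum_nonpos fun _ _ => inner_laplacian_nonpos _ _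
  have hx1 : (x.1 : ℝ) ≤ y.1 := by exact_mod_cast h.1
  have hx2 : (x.2 : ℝ) ≤ y.2 := by exact_mod_cast h.2
  linarith [mul_le_mul_of_nonpos_right hx1 h1, mul_le_mul_of_nonpos_right hx2 h2]

theorem convexOn_twoRateEnergy : ConvexOn ℝ≥0 Set.univ (twoRateEnergy d p n) := by
  refine ⟨convex_univ, fun x _ y _ a b _ _ hab => ?_⟩
  rw [twoRateEnergy_le_iff]
  intro f hf
  have hx := mul_le_mul_of_nonneg_left (le_twoRateEnergy x hf) a.2
  have hy := mul_le_mul_of_nonneg_left (le_twoRateEnergy y hf) b.2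
  have hab' : (a : ℝ) + b = 1 := by exact_mod_cast hab
  have e : inner ℝ f (contactOp Sum.isLeft f) =
      a * inner ℝ f (contactOp Sum.isLeft f) + b * inner ℝ f (contactOp Sum.isLeft f) := by
    rw [← add_mul, hab', one_mul]
  simp only [Prod.fst_add, Prod.snd_add, Prod.smul_fst, Prod.smul_snd, smul_eq_mul, NNReal.coe_add,
    NNReal.coe_mul, NNReal.smul_def]
  rw [e]
  refine le_trans (le_of_eq ?_) (add_le_add hx hy)
  simp only [NNReal.val_eq_coe]
  ring

theorem continuous_twoRateEnergy : Continuous (twoRateEnergy d p n) := by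
  set C : ℝ := ∑ j : Fin p, ‖laplacian (d := d) (Sum.inl j : Fin p ⊕ Fin n)‖ +
    ∑ k : Fin n, ‖laplacian (d := d) (Sum.inr k : Fin p ⊕ Fin n)‖ with hC
  have hC0 : 0 ≤ C := by positivity
  have hbd : ∀ (ι : Fin p ⊕ Fin n) (f : L2 (Conf (Fin p ⊕ Fin n) d)), ‖f‖ = 1 →
      |inner ℝ f (laplacian ι f)| ≤ ‖laplacian (d := d) ι‖ := by
    intro ι f hf
    refine (abs_real_inner_le_norm _ _).trans ?_
    simpa [hf] using (laplacian ι).le_opNorm f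
  -- The slopes of the affine functions are bounded by norms of Laplacians, uniformly in unit `f`.
  have hlip : LipschitzWith C.toNNReal (twoRateEnergy d p n) := by
    refine LipschitzWith.of_le_add_mul _ fun x y => ?_
    rw [twoRateEnergy_le_iff, Real.coe_toNNReal _ hC0]
    intro f hf
    have hy := le_twoRateEnergy y hf
    have h1 : |∑ j : Fin p, inner ℝ f (laplacian (Sum.inl j) f)| ≤
        ∑ j : Fin p, ‖laplacian (d := d) (Sum.inl j : Fin p ⊕ Fin n)‖ :=
      (Finset.abs_sum_le_sum_abs _ _).trans (Finset.sum_le_sum fun j _ => hbd _ f hf)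
    have h2 : |∑ k : Fin n, inner ℝ f (laplacian (Sum.inr k) f)| ≤
        ∑ k : Fin n, ‖laplacian (d := d) (Sum.inr k : Fin p ⊕ Fin n)‖ :=
      (Finset.abs_sum_le_sum_abs _ _).trans (Finset.sum_le_sum fun j _ => hbd _ f hf)
    have d1 : |(x.1 : ℝ) - y.1| ≤ dist x y := le_max_left _ _
    have d2 : |(x.2 : ℝ) - y.2| ≤ dist x y := le_max_right _ _
    have e1 := (le_abs_self _).trans ((abs_mul _ _).le.trans
      (mul_le_mul d1 h1 (abs_nonneg _) dist_nonneg))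
    have e2 := (le_abs_self _).trans ((abs_mul _ _).le.trans
      (mul_le_mul d2 h2 (abs_nonneg _) dist_nonneg))
    rw [hC]
    linarith
  exact hlip.continuous

/-- The configuration with the `p` particles at `x` and the `n` particles at the origin. -/
def startConf (p n : ℕ) (x : Fin d → ℤ) : Conf (Fin p ⊕ Fin n) d :=
  Sum.elim (fun _ => x) fun _ => 0

/-- Contacts are symmetric in the two colours, so the reduction for frozen particles of colour
`false` also covers the `p` walkers when `κ = 0`. -/
theorem hamiltonian_not {I : Type*} [Fintype I] [DecidableEq I] (col : I → Bool) (r : I → ℝ≥0) :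
    hamiltonian (d := d) (fun i => !col i) r = hamiltonian col r := by
  have : contactOp (d := d) (fun i => !col i) = contactOp col := by
    ext f z
    simp [contactOp, contacts_not]
  simp [hamiltonian, this]

theorem hamiltonian_twoRates_zero :
    hamiltonian (d := d) Sum.isLeft (twoRates p n 0 0) = contactOp Sum.isLeft := by
  have : twoRates p n 0 0 = 0 := by
    ext i; cases i <;> rfl
  simp [hamiltonian, this]

/-- The top energy is determined by functions supported on the configurations that can be reached
from the starting configuration. -/
theorem twoRateEnergy_le_of_reachable (hp : 1 ≤ p) (hn : 1 ≤ n) (κ ρ : ℝ≥0) (x : Fin d → ℤ)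
    (hx : (κ, ρ) ≠ (0, 0) ∨ x = 0) (ν : ℝ)
    (h : ∀ g : L2 (Conf (Fin p ⊕ Fin n) d),
      (∀ w, g w ≠ 0 → ∀ ι, twoRates p n κ ρ ι = 0 → w ι = startConf p n x ι) →
      inner ℝ g (hamiltonian Sum.isLeft (twoRates p n κ ρ) g) ≤ ν * ‖g‖ ^ 2) :
    topEnergy d Sum.isLeft (twoRates p n κ ρ) ≤ ν := by
  by_cases hκ : κ = 0
  · by_cases hρ : ρ = 0
    · subst hκ hρ
      obtain rfl : x = 0 := by simpa using hx
      have hstart : startConf (d := d) p n 0 = 0 := by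
        funext ι; cases ι <;> rfl
      -- Without motion the energy is the potential alone. The only reachable configuration is the
      -- origin, where the potential is maximal, and `h0` bounds that maximum by `ν`.
      have h0 := h (delta 0) (by
        intro w hw ι _
        have : w = 0 := by
          by_contra hne
          exact hw (by rw [delta_apply, if_neg hne])
        rw [this, hstart])
      rw [hamiltonian_twoRates_zero, inner_delta_left, contactOp, mulOp_apply, norm_delta,
        delta_apply, if_pos rfl, mul_one, one_pow, mul_one] at h0
      rw [topEnergy_le_iff]
      intro f
      rw [hamiltonian_twoRates_zero]
      refine hasSum_le (fun z => ?_) (hasSum_mul f (contactOp Sum.isLeft f))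
        ((hasSum_sq f).mul_left ν)
      rw [contactOp, mulOp_apply]
      have := contacts_le Sum.isLeft z
      nlinarith [sq_nonneg (f z)]
    · subst hκ
      rw [topEnergy_le_iff, ← hamiltonian_not]
      refine inner_hamiltonian_le_of_frozen (v := x) ?_ ⟨Sum.inl ⟨0, hp⟩, rfl⟩ fun g hg => ?_
      · rintro (j | k) hι
        · rfl
        · simp at hι
      · rw [hamiltonian_not]
        refine h g fun w hw ι hι => ?_
        rcases ι with j | k
        · exact hg w hw _ rfl
        · exact absurd hι hρ
  · by_cases hρ : ρ = 0
    · subst hρ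
      rw [topEnergy_le_iff]
      refine inner_hamiltonian_le_of_frozen (v := 0) ?_ ⟨Sum.inr ⟨0, hn⟩, rfl⟩ fun g hg => ?_
      · rintro (j | k) hι
        · simp at hι
        · rfl
      · refine h g fun w hw ι hι => ?_
        rcases ι with j | k
        · exact absurd hι hκ
        · exact hg w hw _ rfl
    -- Both rates are positive, so the support condition is vacuous.
    · rw [topEnergy_le_iff]
      refine fun f => h f fun w _ ι hι => ?_
      rcases ι with j | k
      · exact absurd hι hκ
      · exact absurd hι hρ

theorem kernelFK_twoRates_zero (t : ℝ) {x : Fin d → ℤ} (hx : x ≠ 0) :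
    kernelFK Sum.isLeft (twoRates p n 0 0) t (startConf p n x) (startConf p n x) = 1 := by
  have h0 : contacts Sum.isLeft (startConf p n x) = 0 := by
    refine Finset.sum_eq_zero fun j _ => Finset.sum_eq_zero fun k _ => if_neg ?_
    rintro ⟨hj, hk, h⟩
    rcases j with j | j
    · rcases k with k | k
      · simp at hk
      · exact hx h
    · simp at hj
  rw [kernelFK, hamiltonian_twoRates_zero, contactOp, exp_smul_mulOp_apply, h0, delta_apply]
  simp

end TwoRates

end

/-! ### Short-time and tail estimates for the displacement law -/

noncomputable section

section Displacement

variable {d : ℕ}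

theorem isProbabilityMeasure_stepLaw (hd : 1 ≤ d) : IsProbabilityMeasure (stepLaw d) := by
  constructor
  have h2 : (2 * d : ℝ≥0∞) ≠ 0 := by simp; omega
  have h3 : (2 * d : ℝ≥0∞) ≠ ∞ := by finiteness
  simp only [stepLaw, Measure.finsetSum_apply, Measure.smul_apply, Measure.add_apply,
    measure_univ, Finset.sum_const, Finset.card_univ, Fintype.card_fin, smul_eq_mul, nsmul_eq_mul]
  rw [one_add_one_eq_two, mul_left_comm, mul_comm (d : ℝ≥0∞), ENNReal.inv_mul_cancel h2 h3]

theorem isProbabilityMeasure_stepsLaw (hd : 1 ≤ d) (k : ℕ) :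
    IsProbabilityMeasure (stepsLaw d k) := by
  have := isProbabilityMeasure_stepLaw hd
  induction k with
  | zero => exact Measure.dirac.isProbabilityMeasure
  | succ k ih => rw [stepsLaw]; infer_instance

theorem displacementLaw_apply (κ t : ℝ≥0) (A : Set (Fin d → ℤ)) :
    displacementLaw d κ t A =
      ∑' k : ℕ, poissonMeasure (2 * d * κ * t) {k} * stepsLaw d k A := by
  simp [displacementLaw, Measure.sum_apply _ (MeasurableSet.of_discrete (s := A))]

theorem tsum_poissonMeasure_singleton (r : ℝ≥0) : ∑' k : ℕ, poissonMeasure r {k} = 1 := by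
  rw [← measure_univ (μ := poissonMeasure r), ← Set.iUnion_of_singleton ℕ,
    measure_iUnion (fun i j hij => by simpa using hij) fun i => MeasurableSet.singleton i]

theorem isProbabilityMeasure_displacementLaw (hd : 1 ≤ d) (κ t : ℝ≥0) :
    IsProbabilityMeasure (displacementLaw d κ t) := by
  constructor
  have := isProbabilityMeasure_stepsLaw hd
  simp [displacementLaw_apply, tsum_poissonMeasure_singleton]

theorem exp_neg_le_displacementLaw_zero (κ t : ℝ≥0) :
    ENNReal.ofReal (Real.exp (-(2 * d * κ * t))) ≤ displacementLaw d κ t {0} := by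
  rw [displacementLaw_apply]
  refine le_trans ?_ (ENNReal.le_tsum 0)
  simp [poissonMeasure_singleton, stepsLaw]

theorem le_stepLaw_singleton (i : Fin d) {c : Fin d → ℤ}
    (hc : c = Pi.single i 1 ∨ c = -Pi.single i 1) : (2 * d : ℝ≥0∞)⁻¹ ≤ stepLaw d {c} := by
  simp only [stepLaw, Measure.finsetSum_apply, Measure.smul_apply, Measure.add_apply, smul_eq_mul]
  refine le_trans ?_ (Finset.single_le_sum (fun _ _ => zero_le) (Finset.mem_univ i))
  conv_lhs => rw [← mul_one (2 * d : ℝ≥0∞)⁻¹]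
  gcongr
  rcases hc with rfl | rfl
  · simp
  · rw [← Pi.single_neg]
    simp

/-- The one-jump term of the Poisson sum: the factor 2d in the rate cancels the 1/(2d) of the step
law. -/
theorem exp_mul_le_displacementLaw_step (κ t : ℝ≥0) (i : Fin d) {c : Fin d → ℤ}
    (hc : c = Pi.single i 1 ∨ c = -Pi.single i 1) :
    ENNReal.ofReal (Real.exp (-(2 * d * κ * t)) * (κ * t)) ≤ displacementLaw d κ t {c} := by
  rw [displacementLaw_apply]
  refine le_trans ?_ (ENNReal.le_tsum 1)
  have h1 : stepsLaw d 1 = stepLaw d := by simp [stepsLaw]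
  have hd : 0 < d := i.pos
  rw [h1, poissonMeasure_singleton]
  refine le_trans (le_of_eq ?_) (mul_le_mul_right (le_stepLaw_singleton i hc) _)
  have e : (2 * d : ℝ≥0∞)⁻¹ = ENNReal.ofReal ((2 * d : ℝ)⁻¹) := by
    rw [ENNReal.ofReal_inv_of_pos (by positivity), ENNReal.ofReal_mul (by norm_num)]
    simp
  rw [e, ← ENNReal.ofReal_mul (by positivity)]
  congr 1
  push_cast
  field_simp
  simp

/-- The exponential of the supremum norm. -/
def expNorm (z : Fin d → ℤ) : ℝ≥0∞ := ENNReal.ofReal (Real.exp ‖z‖)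

theorem expNorm_add_le (a b : Fin d → ℤ) : expNorm (a + b) ≤ expNorm a * expNorm b := by
  rw [expNorm, expNorm, expNorm, ← ENNReal.ofReal_mul (Real.exp_pos _).le, ← Real.exp_add]
  exact ENNReal.ofReal_le_ofReal (Real.exp_le_exp.2 (norm_add_le a b))

theorem lintegral_expNorm_stepLaw_le (hd : 1 ≤ d) :
    ∫⁻ z, expNorm z ∂stepLaw d ≤ ENNReal.ofReal (Real.exp 1) := by
  have := isProbabilityMeasure_stepLaw hd
  have hae : ∀ᵐ z ∂stepLaw d, expNorm z ≤ ENNReal.ofReal (Real.exp 1) := by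
    have hs : ∀ (i : Fin d) (m : ℤ), ‖m‖ ≤ 1 →
        expNorm (Pi.single i m : Fin d → ℤ) ≤ ENNReal.ofReal (Real.exp 1) := by
      intro i m hm
      refine ENNReal.ofReal_le_ofReal (Real.exp_le_exp.2 ?_)
      rw [pi_norm_le_iff_of_nonneg zero_le_one]
      intro j
      rw [Pi.single_apply]
      split_ifs
      · exact hm
      · simp
    rw [ae_iff, stepLaw]
    simp only [Measure.finsetSum_apply, Measure.smul_apply, Measure.add_apply, smul_eq_mul]
    refine Finset.sum_eq_zero fun i _ => ?_
    rw [Measure.dirac_apply' _ MeasurableSet.of_discrete,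
      Measure.dirac_apply' _ MeasurableSet.of_discrete, Set.indicator_of_notMem,
      Set.indicator_of_notMem]
    · simp
    · simpa using hs i (-1) (by simp)
    · simpa using hs i 1 (by simp)
  calc ∫⁻ z, expNorm z ∂stepLaw d ≤ ∫⁻ _, ENNReal.ofReal (Real.exp 1) ∂stepLaw d :=
        lintegral_mono_ae hae
    _ = _ := by simp

theorem lintegral_expNorm_stepsLaw_le (hd : 1 ≤ d) (k : ℕ) :
    ∫⁻ z, expNorm z ∂stepsLaw d k ≤ ENNReal.ofReal (Real.exp 1) ^ k := by
  have := isProbabilityMeasure_stepLaw hd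
  have := isProbabilityMeasure_stepsLaw hd
  induction k with
  | zero => simp [stepsLaw, expNorm]
  | succ k ih =>
    rw [stepsLaw, Measure.lintegral_conv .of_discrete, pow_succ]
    calc _ ≤ ∫⁻ a, ∫⁻ b, expNorm a * expNorm b ∂stepLaw d ∂stepsLaw d k :=
          lintegral_mono fun a => lintegral_mono fun b => expNorm_add_le a b
      _ = (∫⁻ a, expNorm a ∂stepsLaw d k) * ∫⁻ b, expNorm b ∂stepLaw d := by
          simp_rw [lintegral_const_mul _ (Measurable.of_discrete (f := expNorm (d := d)))]
          rw [lintegral_mul_const _ .of_discrete]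
      _ ≤ _ := mul_le_mul' ih (lintegral_expNorm_stepLaw_le hd)

/-- Steps have norm at most 1, so k steps contribute at most exp k; the Poisson generating function
at e gives the bound. -/
theorem lintegral_expNorm_displacementLaw_le (hd : 1 ≤ d) (κ t : ℝ≥0) :
    ∫⁻ z, expNorm z ∂displacementLaw d κ t ≤
      ENNReal.ofReal (Real.exp (2 * d * κ * t * (Real.exp 1 - 1))) := by
  rw [displacementLaw, lintegral_sum_measure]
  simp_rw [lintegral_smul_measure, smul_eq_mul]
  set r : ℝ≥0 := 2 * d * κ * t with hr
  have hs : HasSum (fun k : ℕ => Real.exp (-r) * ((r * Real.exp 1) ^ k / k.factorial))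
      (Real.exp (-r) * Real.exp (r * Real.exp 1)) := by
    refine HasSum.mul_left _ ?_
    rw [Real.exp_eq_exp_ℝ]
    exact NormedSpace.expSeries_div_hasSum_exp _
  calc _ ≤ ∑' k : ℕ, ENNReal.ofReal (Real.exp (-r) * ((r * Real.exp 1) ^ k / k.factorial)) := by
        refine ENNReal.tsum_le_tsum fun k => ?_
        refine (mul_le_mul_right (lintegral_expNorm_stepsLaw_le hd k) _).trans (le_of_eq ?_)
        rw [poissonMeasure_singleton, ← ENNReal.ofReal_pow (Real.exp_pos _).le,
          ← ENNReal.ofReal_mul (by positivity)]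
        congr 1
        rw [mul_pow]
        ring
    _ = ENNReal.ofReal (Real.exp (-r) * Real.exp (r * Real.exp 1)) := by
        rw [← ENNReal.ofReal_tsum_of_nonneg (fun k => by positivity) hs.summable, hs.tsum_eq]
    _ = _ := by
        rw [← Real.exp_add, hr]
        push_cast
        congr 2
        ring

theorem displacementLaw_norm_gt_le (hd : 1 ≤ d) (κ t : ℝ≥0) (R : ℝ) :
    displacementLaw d κ t {z | R < ‖z‖} ≤
      ENNReal.ofReal (Real.exp (2 * d * κ * t * (Real.exp 1 - 1) - R)) := by
  have h := mul_meas_ge_le_lintegral₀ (μ := displacementLaw d κ t) (f := expNorm (d := d))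
    Measurable.of_discrete.aemeasurable (ENNReal.ofReal (Real.exp R))
  have h2 : displacementLaw d κ t {z | R < ‖z‖} ≤
      displacementLaw d κ t {z | ENNReal.ofReal (Real.exp R) ≤ expNorm z} := by
    refine measure_mono fun z hz => ?_
    exact ENNReal.ofReal_le_ofReal (Real.exp_le_exp.2 (le_of_lt hz))
  have hpos : ENNReal.ofReal (Real.exp R) ≠ 0 := by simp [Real.exp_pos]
  rw [Real.exp_sub, ENNReal.ofReal_div_of_pos (Real.exp_pos _),
    ENNReal.le_div_iff_mul_le (Or.inl hpos) (Or.inl ENNReal.ofReal_ne_top), mul_comm]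
  exact (mul_le_mul_right h2 _).trans (h.trans (lintegral_expNorm_displacementLaw_le hd κ t))

end Displacement

end

/-! ### Averaging operators, Trotter formula and discretized Feynman-Kac -/

noncomputable section

section Averaging

open L2

variable {S : Type*} [AddCommGroup S]

theorem summable_smul_shift {w : S → ℝ} (hw : Summable w) (hw0 : ∀ c, 0 ≤ w c) :
    Summable fun c => w c • shift c := by
  refine Summable.of_norm_bounded hw fun c => ?_
  rw [norm_smul, Real.norm_of_nonneg (hw0 c)]
  exact mul_le_of_le_one_right (hw0 c) (norm_shift_le c)

theorem norm_tsum_smul_shift_le {w : S → ℝ} (hw : Summable w) (hw0 : ∀ c, 0 ≤ w c) :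
    ‖∑' c, w c • shift c‖ ≤ ∑' c, w c := by
  refine tsum_of_norm_bounded hw.hasSum fun c => ?_
  rw [norm_smul, Real.norm_of_nonneg (hw0 c)]
  exact mul_le_of_le_one_right (hw0 c) (norm_shift_le c)

variable [MeasurableSpace S] [Countable S] [MeasurableSingletonClass S]

/-- The operator that averages the translates of a function with respect to a measure. -/
def averageOp (π : Measure S) : L2 S →L[ℝ] L2 S := ∑' c, π.real {c} • shift c

theorem hasSum_real_singleton (π : Measure S) [IsProbabilityMeasure π] :
    HasSum (fun c => π.real {c}) 1 := by
  have h := hasSum_integral_iUnion (μ := π) (f := fun _ : S => (1 : ℝ)) (s := fun c : S => {c})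
    (fun c => MeasurableSet.singleton c) (fun i j hij => by simpa using hij)
    (integrable_const 1).integrableOn
  rw [Set.iUnion_of_singleton] at h
  simpa [measureReal_def] using h

theorem integrable_of_l2 (π : Measure S) [IsProbabilityMeasure π] (f : L2 S) (z : S) :
    Integrable (fun c => f (z + c)) π :=
  Integrable.of_bound (Measurable.of_discrete.aestronglyMeasurable) ‖f‖
    (Eventually.of_forall fun c => lp.norm_apply_le_norm (p := 2) (by simp) f (z + c))

theorem averageOp_apply (π : Measure S) [IsProbabilityMeasure π] (f : L2 S) (z : S) :
    averageOp π f z = ∫ c, f (z + c) ∂π := by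
  have hs := (summable_smul_shift (hasSum_real_singleton π).summable fun c =>
    measureReal_nonneg).hasSum.mapL ((evalCLM z).comp (ContinuousLinearMap.apply ℝ (L2 S) f))
  rw [integral_countable (integrable_of_l2 π f z)]
  refine hs.tsum_eq.symm.trans (tsum_congr fun c => ?_)
  simp

end Averaging

section Steps

open L2

variable {I : Type*} [Fintype I] [DecidableEq I] {d : ℕ}

/-- The steps `± e_i` of the particles; the Boolean is the sign. -/
def stepVec (e : I × Fin d × Bool) : Conf I d :=
  if e.2.2 then unitStep e.1 e.2.1 else -unitStep e.1 e.2.1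

theorem stepVec_apply (e : I × Fin d × Bool) (ι : I) (i : Fin d) : stepVec e ι i =
    if e.1 = ι ∧ e.2.1 = i then (if e.2.2 then 1 else -1) else 0 := by
  obtain ⟨ι', i', b⟩ := e
  by_cases h1 : ι' = ι
  · subst h1
    by_cases h2 : i' = i
    · subst h2
      cases b <;> simp [stepVec, unitStep]
    · cases b <;> simp [stepVec, unitStep, h2, Ne.symm h2]
  · cases b <;> simp [stepVec, unitStep, h1, Ne.symm h1]

theorem stepVec_ne_zero (e : I × Fin d × Bool) : stepVec e ≠ 0 := by
  intro h
  have := congrFun (congrFun h e.1) e.2.1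
  rw [stepVec_apply] at this
  cases hb : e.2.2 <;> simp [hb] at this

theorem stepVec_injective : Function.Injective (stepVec : I × Fin d × Bool → Conf I d) := by
  rintro ⟨ι, i, b⟩ ⟨ι', i', b'⟩ h
  have h1 := congrFun (congrFun h ι) i
  rw [stepVec_apply, stepVec_apply] at h1
  by_cases hc : ι' = ι ∧ i' = i
  · obtain ⟨rfl, rfl⟩ := hc
    cases b <;> cases b' <;> simp at h1 ⊢
  · rw [if_neg hc] at h1
    cases b <;> simp at h1

theorem stepVec_self (e : I × Fin d × Bool) :
    stepVec e e.1 = Pi.single e.2.1 1 ∨ stepVec e e.1 = -Pi.single e.2.1 1 := by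
  unfold stepVec unitStep
  split_ifs <;> simp

theorem stepVec_of_ne (e : I × Fin d × Bool) {ι : I} (h : ι ≠ e.1) : stepVec e ι = 0 := by
  funext i
  rw [stepVec_apply, if_neg (fun hc => h hc.1.symm)]
  rfl

/-- What is used of the displacement laws over a short time `h`: lower bounds for the probabilities
of no step and of exactly one step. -/
structure IsStepFamily (r : I → ℝ≥0) (h : ℝ≥0) (m : I → Measure (Fin d → ℤ)) : Prop where
  prob : ∀ ι, IsProbabilityMeasure (m ι)
  zero_le : ∀ ι, Real.exp (-(2 * d * r ι * h)) ≤ (m ι).real {0}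
  step_le : ∀ ι i c, (c = Pi.single i 1 ∨ c = -Pi.single i 1) →
    Real.exp (-(2 * d * r ι * h)) * (r ι * h) ≤ (m ι).real {c}

/-- Lower bound for the probability of a configuration of displacements. -/
def stepWeight (r : I → ℝ≥0) (h : ℝ≥0) (c : Conf I d) : ℝ :=
  Real.exp (-(h * ∑ ι, (r ι : ℝ) * (2 * d))) * ((if c = 0 then 1 else 0) +
    h * ∑ e : I × Fin d × Bool, (r e.1 : ℝ) * if c = stepVec e then 1 else 0)

theorem pi_real_singleton (m : I → Measure (Fin d → ℤ)) [∀ ι, IsProbabilityMeasure (m ι)]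
    (c : Conf I d) : (Measure.pi m).real {c} = ∏ ι, (m ι).real {c ι} := by
  simp [measureReal_def, Measure.pi_singleton, ENNReal.toReal_prod]

theorem stepWeight_le {r : I → ℝ≥0} {h : ℝ≥0} {m : I → Measure (Fin d → ℤ)}
    (hm : IsStepFamily r h m) (c : Conf I d) : stepWeight r h c ≤ (Measure.pi m).real {c} := by
  have := hm.prob
  have hprod : Real.exp (-(h * ∑ ι, (r ι : ℝ) * (2 * d))) =
      ∏ ι, Real.exp (-(2 * d * r ι * h)) := by
    rw [← Real.exp_sum, Finset.mul_sum, ← Finset.sum_neg_distrib]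
    congr 1
    exact Finset.sum_congr rfl fun ι _ => by ring
  rw [pi_real_singleton, stepWeight, hprod]
  by_cases h0 : c = 0
  · subst h0
    simp only [if_true, (stepVec_ne_zero _).symm, if_false, mul_zero, Finset.sum_const_zero,
      add_zero, mul_one]
    exact Finset.prod_le_prod (fun ι _ => (Real.exp_pos _).le) fun ι _ => hm.zero_le ι
  · rw [if_neg h0, zero_add]
    by_cases hc : ∃ e, c = stepVec e
    · obtain ⟨e, rfl⟩ := hc
      rw [Finset.sum_eq_single e (fun e' _ he' => by
        rw [if_neg (fun h => he' (stepVec_injective h).symm), mul_zero]) (by simp), if_pos rfl,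
        mul_one, ← Finset.mul_prod_erase _ _ (Finset.mem_univ e.1),
        ← Finset.mul_prod_erase _ _ (Finset.mem_univ e.1)]
      calc _ = (Real.exp (-(2 * d * r e.1 * h)) * (r e.1 * h)) *
            ∏ x ∈ Finset.univ.erase e.1, Real.exp (-(2 * d * r x * h)) := by ring
        _ ≤ _ := by
          refine mul_le_mul (hm.step_le _ _ _ (stepVec_self e)) ?_
            (Finset.prod_nonneg fun _ _ => (Real.exp_pos _).le) measureReal_nonneg
          refine Finset.prod_le_prod (fun ι _ => (Real.exp_pos _).le) fun ι hι => ?_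
          rw [stepVec_of_ne e (Finset.ne_of_mem_erase hι)]
          exact hm.zero_le ι
    · push Not at hc
      simp only [hc, if_false, mul_zero, Finset.sum_const_zero]
      exact Finset.prod_nonneg fun _ _ => measureReal_nonneg

theorem hasSum_stepWeight_smul {E : Type*} [NormedAddCommGroup E] [NormedSpace ℝ E]
    (r : I → ℝ≥0) (h : ℝ≥0) (g : Conf I d → E) :
    HasSum (fun c => stepWeight r h c • g c) (Real.exp (-(h * ∑ ι, (r ι : ℝ) * (2 * d))) •
      (g 0 + (h : ℝ) • ∑ ι, (r ι : ℝ) • ∑ i : Fin d, (g (unitStep ι i) + g (-unitStep ι i)))) := by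
  have e : ∑ ι, (r ι : ℝ) • ∑ i : Fin d, (g (unitStep ι i) + g (-unitStep ι i)) =
      ∑ e : I × Fin d × Bool, (r e.1 : ℝ) • g (stepVec e) := by
    simp [Fintype.sum_prod_type, stepVec, ← Finset.smul_sum]
  rw [e]
  have h1 : ∀ a : Conf I d, HasSum (fun c => if c = a then g a else 0) (g a) :=
    fun a => hasSum_ite_eq a (g a)
  have h2 := ((h1 0).add ((hasSum_sum (s := Finset.univ) fun (e : I × Fin d × Bool) _ =>
    (h1 (stepVec e)).const_smul (r e.1 : ℝ)).const_smul (h : ℝ))).const_smul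
      (Real.exp (-(h * ∑ ι, (r ι : ℝ) * (2 * d))))
  refine h2.congr_fun fun c => ?_
  rw [stepWeight, mul_smul, add_smul, mul_smul, Finset.sum_smul]
  have h3 : ∀ a : Conf I d, (if c = a then (1 : ℝ) else 0) • g c = if c = a then g a else 0 := by
    intro a
    split_ifs with hc
    · rw [hc, one_smul]
    · rw [zero_smul]
  simp only [mul_smul, h3]

theorem hasSum_stepWeight (r : I → ℝ≥0) (h : ℝ≥0) : HasSum (stepWeight (d := d) r h)
    (Real.exp (-(h * ∑ ι, (r ι : ℝ) * (2 * d))) * (1 + h * ∑ ι, (r ι : ℝ) * (2 * d))) := by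
  have := hasSum_stepWeight_smul (d := d) r h fun _ => (1 : ℝ)
  simpa [one_add_one_eq_two, mul_comm (d : ℝ)] using this

/-- The law dominates `stepWeight` pointwise and translations are contractions, so the operator
error is at most the missing mass. Because total mass is 1, lower bounds for zero and one step
suffice, and the missing mass is of second order in `h`. -/
theorem norm_averageOp_sub_le {r : I → ℝ≥0} {h : ℝ≥0} {m : I → Measure (Fin d → ℤ)}
    (hm : IsStepFamily r h m) :
    ‖averageOp (Measure.pi m) - Real.exp (-(h * ∑ ι, (r ι : ℝ) * (2 * d))) •
      (1 + (h : ℝ) • ∑ ι, (r ι : ℝ) • ∑ i : Fin d,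
        (shift (unitStep ι i) + shift (-unitStep ι i)))‖ ≤
      1 - Real.exp (-(h * ∑ ι, (r ι : ℝ) * (2 * d))) * (1 + h * ∑ ι, (r ι : ℝ) * (2 * d)) := by
  have := hm.prob
  have h1 := hasSum_real_singleton (Measure.pi m)
  have h2 := hasSum_stepWeight_smul r h (shift : Conf I d → _)
  rw [shift_zero] at h2
  have h3 := h1.sub (hasSum_stepWeight (d := d) r h)
  have h4 := (summable_smul_shift h1.summable fun c => measureReal_nonneg).hasSum.sub h2
  rw [averageOp, ← h4.tsum_eq, ← h3.tsum_eq]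
  simp_rw [← sub_smul]
  exact norm_tsum_smul_shift_le h3.summable fun c => sub_nonneg.2 (stepWeight_le hm c)

theorem tendsto_nat_mul_of_hasDerivAt {E : Type*} [NormedAddCommGroup E] [NormedSpace ℝ E]
    {f : ℝ → E} {f' : E} (hf : HasDerivAt f f' 0) (t : ℝ) :
    Tendsto (fun N : ℕ => (N : ℝ) • (f (t / N) - f 0)) atTop (𝓝 (t • f')) := by
  have h0 : HasDerivAt (fun s : ℝ => f (t * s)) (t • f') 0 := by
    have h1 : HasDerivAt (fun s : ℝ => t * s) t 0 := by
      simpa using (hasDerivAt_id (0 : ℝ)).const_mul t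
    have h2 : HasDerivAt f f' (t * 0) := by simpa using hf
    exact h2.scomp 0 h1
  have h2 : Tendsto (fun k : ℕ => ((k : ℝ)⁻¹)) atTop (𝓝[≠] 0) := by
    refine tendsto_nhdsWithin_iff.2 ⟨tendsto_inv_atTop_nhds_zero_nat, ?_⟩
    filter_upwards [eventually_ne_atTop 0] with k hk
    simpa using hk
  refine (h0.tendsto_slope_zero.comp h2).congr fun k => ?_
  simp [div_eq_mul_inv]

theorem tendsto_nat_smul_averageOp_sub_one {r : I → ℝ≥0} (t : ℝ≥0)
    (m : ℕ → I → Measure (Fin d → ℤ)) (hm : ∀ N : ℕ, IsStepFamily r (t / N) (m N)) :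
    Tendsto (fun N : ℕ => (N : ℝ) • (averageOp (Measure.pi (m N)) - 1)) atTop
      (𝓝 ((t : ℝ) • ∑ ι, (r ι : ℝ) • laplacian (d := d) ι)) := by
  set γ : ℝ := ∑ ι, (r ι : ℝ) * (2 * d) with hγ
  set K : L2 (Conf I d) →L[ℝ] L2 (Conf I d) :=
    ∑ ι, (r ι : ℝ) • ∑ i : Fin d, (shift (unitStep ι i) + shift (-unitStep ι i)) with hK
  have hexp : HasDerivAt (fun s : ℝ => Real.exp (-(s * γ))) (-γ) 0 := by
    simpa using ((hasDerivAt_id (0 : ℝ)).mul_const γ).neg.exp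
  have hA : HasDerivAt (fun s : ℝ => Real.exp (-(s * γ)) • (1 + s • K)) (K - γ • 1) 0 := by
    have hl : HasDerivAt (fun s : ℝ => 1 + s • K) K 0 := by
      simpa using ((hasDerivAt_id (0 : ℝ)).smul_const K).const_add 1
    refine (hexp.smul hl).congr_deriv ?_
    simp [sub_eq_add_neg]
  have hB : HasDerivAt (fun s : ℝ => 1 - Real.exp (-(s * γ)) * (1 + s * γ)) 0 0 := by
    have hl : HasDerivAt (fun s : ℝ => 1 + s * γ) γ 0 := by
      simpa using ((hasDerivAt_id (0 : ℝ)).mul_const γ).const_add 1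
    refine ((hexp.mul hl).const_sub 1).congr_deriv ?_
    simp
  have hlap : ∑ ι, (r ι : ℝ) • laplacian (d := d) ι = K - γ • 1 := by
    -- The colouring is immaterial: the contact term cancels and leaves the identity for the
    -- Laplacians.
    have h := hamiltonian_add_eq (d := d) (fun _ => true) r
    rw [hamiltonian, add_right_comm, ← hK] at h
    exact eq_sub_of_add_eq (add_right_cancel h)
  rw [hlap]
  have hA' := tendsto_nat_mul_of_hasDerivAt hA t
  have hB' := tendsto_nat_mul_of_hasDerivAt hB t
  simp only [zero_mul, neg_zero, Real.exp_zero, zero_smul, add_zero, one_smul, mul_zero, mul_one,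
    sub_self, sub_zero, smul_eq_mul] at hA' hB'
  have hdiff : Tendsto (fun N : ℕ => (N : ℝ) • (averageOp (Measure.pi (m N)) -
      Real.exp (-((t : ℝ) / N * γ)) • (1 + ((t : ℝ) / N) • K))) atTop (𝓝 0) := by
    refine squeeze_zero_norm (fun N => ?_) hB'
    rw [norm_smul, Real.norm_of_nonneg (Nat.cast_nonneg N)]
    gcongr
    have := norm_averageOp_sub_le (hm N)
    push_cast at this
    exact this
  have := hdiff.add hA'
  rw [zero_add] at this
  refine this.congr fun N => ?_
  rw [← smul_add, sub_add_sub_cancel]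

/-- One step of the discretized Feynman-Kac semigroup. -/
def stepOp (col : I → Bool) (h : ℝ) (π : Measure (Conf I d)) : L2 (Conf I d) →L[ℝ] L2 (Conf I d) :=
  NormedSpace.exp (h • contactOp col) * averageOp π

theorem stepOp_apply (col : I → Bool) (h : ℝ) (π : Measure (Conf I d)) [IsProbabilityMeasure π]
    (f : L2 (Conf I d)) (z : Conf I d) :
    stepOp col h π f z = Real.exp (h * contacts col z) * ∫ c, f (z + c) ∂π := by
  rw [stepOp, mul_apply_eq_comp, contactOp, exp_smul_mulOp_apply, averageOp_apply]

/-- Trotter's product formula for the Feynman-Kac semigroup. -/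
theorem tendsto_stepOp_pow (col : I → Bool) {r : I → ℝ≥0} (t : ℝ≥0)
    (m : ℕ → I → Measure (Fin d → ℤ)) (hm : ∀ N : ℕ, IsStepFamily r (t / N) (m N)) :
    Tendsto (fun N : ℕ => stepOp col (t / N) (Measure.pi (m N)) ^ N) atTop
      (𝓝 (NormedSpace.exp ((t : ℝ) • hamiltonian col r))) := by
  refine tendsto_pow_exp_of_tendsto_mul_sub_one ContinuousLinearMap.norm_id_le _ _ ?_
  have hB := tendsto_nat_smul_averageOp_sub_one t m hm
  have hV : Tendsto (fun N : ℕ => (N : ℝ) •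
      (NormedSpace.exp (((t : ℝ) / N) • contactOp (d := d) col) - 1)) atTop
      (𝓝 ((t : ℝ) • contactOp col)) := by
    have hd : HasDerivAt (fun s : ℝ => NormedSpace.exp (s • contactOp (d := d) col))
        (contactOp col) 0 := by
      simpa using hasDerivAt_exp_smul_const (𝕂 := ℝ) (contactOp (d := d) col) (0 : ℝ)
    simpa using tendsto_nat_mul_of_hasDerivAt hd t
  have hB1 : Tendsto (fun N : ℕ => averageOp (Measure.pi (m N))) atTop (𝓝 1) := by
    have h := (tendsto_inv_atTop_nhds_zero_nat (𝕜 := ℝ)).smul hB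
    rw [zero_smul] at h
    have h2 : Tendsto (fun N : ℕ => averageOp (Measure.pi (m N)) - 1) atTop (𝓝 0) := by
      refine h.congr' ?_
      filter_upwards [eventually_ne_atTop 0] with N hN
      rw [smul_smul, inv_mul_cancel₀ (by exact_mod_cast hN), one_smul]
    simpa using h2.add_const 1
  have := (hV.mul hB1).add hB
  rw [mul_one, ← smul_add] at this
  rw [hamiltonian, add_comm]
  refine this.congr fun N => ?_
  rw [smul_mul_assoc, ← smul_add, stepOp, sub_mul, one_mul, sub_add_sub_cancel]

/-! ### The discretized Feynman-Kac formula -/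

/-- The position before the step `i`, relative to the start, of a walk with the given steps. -/
def partialSum {S : Type*} [AddCommMonoid S] {N : ℕ} (c : Fin N → S) (i : Fin N) : S :=
  ∑ l, if l < i then c l else 0

/-- The potential acts before each step, so the exponent is a Riemann sum at left endpoints. The
induction splits off the first step and restarts the walk from its endpoint. -/
theorem stepOp_pow_apply (col : I → Bool) (h : ℝ) (π : Measure (Conf I d)) [IsProbabilityMeasure π]
    (f : L2 (Conf I d)) (N : ℕ) (z : Conf I d) :
    (stepOp col h π ^ N) f z = ∫ c : Fin N → Conf I d,
      Real.exp (h * ∑ i, contacts col (z + partialSum c i)) * f (z + ∑ i, c i)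
        ∂(Measure.pi fun _ => π) := by
  induction N generalizing z with
  | zero => simp
  | succ N ih =>
    have hmp := (measurePreserving_piFinSuccAbove (fun _ : Fin (N + 1) => π) 0).symm
    rw [← hmp.integral_comp', integral_prod]
    · rw [pow_succ', mul_apply_eq_comp, stepOp_apply, ← integral_const_mul]
      refine integral_congr_ae (Eventually.of_forall fun c0 => ?_)
      simp only
      rw [ih, ← integral_const_mul]
      refine integral_congr_ae (Eventually.of_forall fun c => ?_)
      have hcons : (MeasurableEquiv.piFinSuccAbove (fun _ : Fin (N + 1) => Conf I d) 0).symm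
          (c0, c) = (Fin.cons c0 c : Fin (N + 1) → Conf I d) := Fin.insertNth_zero' c0 c
      simp only [hcons]
      have hp0 : partialSum (Fin.cons c0 c : Fin (N + 1) → Conf I d) 0 = 0 := by
        simp [partialSum]
      have hps : ∀ i : Fin N, partialSum (Fin.cons c0 c : Fin (N + 1) → Conf I d) i.succ =
          c0 + partialSum c i := by
        intro i
        simp [partialSum, Fin.sum_univ_succ]
      rw [← mul_assoc, ← Real.exp_add, ← mul_add]
      simp only [Fin.sum_univ_succ, hp0, hps, Fin.cons_zero, Fin.cons_succ, add_zero, add_assoc]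
    · refine Integrable.of_bound (Measurable.of_discrete.aestronglyMeasurable)
        (Real.exp (|h| * ((N + 1 : ℕ) * contacts col (0 : Conf I d))) * ‖f‖)
        (Eventually.of_forall fun c => ?_)
      rw [norm_mul, Real.norm_eq_abs, Real.abs_exp]
      refine mul_le_mul (Real.exp_le_exp.2 ?_) (lp.norm_apply_le_norm (p := 2) (by simp) f _)
        (norm_nonneg _) (Real.exp_pos _).le
      refine (le_abs_self _).trans ?_
      rw [abs_mul]
      gcongr
      refine (Finset.abs_sum_le_sum_abs _ _).trans ?_
      refine (Finset.sum_le_sum fun i _ => abs_contacts_le col _).trans ?_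
      simp

end Steps

end

/-! ### Riemann sums of the contact time along càdlàg paths -/

noncomputable section

section Riemann

/-- A function of a real variable that is constant on both sides of every point. -/
def EventuallyConstOnSides {α : Type*} (f : ℝ → α) : Prop :=
  ∀ t, (∃ a, ∀ᶠ s in 𝓝[>] t, f s = a) ∧ ∃ b, ∀ᶠ s in 𝓝[<] t, f s = b

/-- Each point has a punctured neighbourhood of continuity points, so the discontinuities form a
locally null set. -/
theorem EventuallyConstOnSides.ae_continuousAt {f : ℝ → ℝ} (hf : EventuallyConstOnSides f) :
    ∀ᵐ t, ContinuousAt f t := by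
  rw [ae_iff]
  refine measure_null_of_locally_null _ fun t _ => ⟨{t}, ?_, by simp⟩
  have key : ∀ (U : Set ℝ) (a : ℝ), IsOpen U → (∀ᶠ s in 𝓝[U] t, f s = a) →
      ∀ᶠ s in 𝓝[U] t, ContinuousAt f s := by
    intro U a hU h
    filter_upwards [eventually_eventually_nhdsWithin.2 h, self_mem_nhdsWithin] with s hs hsU
    rw [hU.nhdsWithin_eq hsU] at hs
    exact continuousAt_const.congr (hs.mono fun u hu => hu.symm)
  obtain ⟨⟨a, ha⟩, ⟨b, hb⟩⟩ := hf t
  have h1 : ∀ᶠ s in 𝓝[≠] t, ContinuousAt f s := by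
    rw [← Set.Iio_union_Ioi, nhdsWithin_union, eventually_sup]
    exact ⟨key _ b isOpen_Iio hb, key _ a isOpen_Ioi ha⟩
  rw [eventually_nhdsWithin_iff] at h1
  rw [mem_nhdsWithin_iff_eventually]
  filter_upwards [h1] with s hs hs2
  by_contra hne
  exact hs2 (hs hne)

/-- Riemann sums at left endpoints converge for bounded functions that are continuous almost
everywhere. -/
theorem tendsto_riemann_sum {g : ℝ → ℝ} (hg : ∀ᵐ s, ContinuousAt g s) {C : ℝ}
    (hC : ∀ s, |g s| ≤ C) {t : ℝ} (ht : 0 < t) :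
    Tendsto (fun N : ℕ => t / N * ∑ i ∈ Finset.range N, g (i * (t / N))) atTop
      (𝓝 (∫ s in (0 : ℝ)..t, g s)) := by
  -- The step function that takes on each interval (it/N, (i+1)t/N] the value of `g` at the left
  -- endpoint. Its sampling point lies within t/N below `s`, so dominated convergence applies at
  -- continuity points.
  set G : ℕ → ℝ → ℝ := fun N s => g (((⌈s / (t / N)⌉₊ - 1 : ℕ) : ℝ) * (t / N)) with hG
  have hmeas : ∀ N, Measurable (G N) := by
    intro N
    have h1 : Measurable fun s : ℝ => ⌈s / (t / N)⌉₊ := Nat.measurable_ceil.comp (by fun_prop)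
    exact (Measurable.of_discrete (f := fun k : ℕ => g (((k - 1 : ℕ) : ℝ) * (t / N)))).comp h1
  have hsum : ∀ N : ℕ, N ≠ 0 →
      ∫ s in (0 : ℝ)..t, G N s = t / N * ∑ i ∈ Finset.range N, g (i * (t / N)) := by
    intro N hN
    have hN' : (0 : ℝ) < N := by positivity
    have hh : 0 < t / N := by positivity
    have h1 := intervalIntegral.sum_integral_adjacent_intervals (μ := volume) (f := G N)
      (a := fun k : ℕ => (k : ℝ) * (t / N)) (n := N) (fun k _ => by
        refine IntervalIntegrable.mono_fun (g := G N) (f := fun _ => C)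
          intervalIntegrable_const (hmeas N).aestronglyMeasurable
          (Eventually.of_forall fun s => ?_)
        exact (hC _).trans (le_abs_self C))
    have e : (N : ℝ) * (t / N) = t := by field_simp
    simp only [Nat.cast_zero, zero_mul, e] at h1
    rw [← h1, Finset.mul_sum]
    refine Finset.sum_congr rfl fun i _ => ?_
    have h2 : ∫ s in (i : ℝ) * (t / N)..((i + 1 : ℕ) : ℝ) * (t / N), G N s =
        ∫ s in (i : ℝ) * (t / N)..((i + 1 : ℕ) : ℝ) * (t / N), g (i * (t / N)) := by
      refine intervalIntegral.integral_congr_ae (Eventually.of_forall fun s hs => ?_)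
      rw [Set.uIoc_of_le (by gcongr; simp)] at hs
      have hc : ⌈s / (t / N)⌉₊ = i + 1 := by
        rw [Nat.ceil_eq_iff (by simp)]
        constructor
        · simp only [Nat.add_sub_cancel]
          rw [lt_div_iff₀ hh]; exact hs.1
        · rw [div_le_iff₀ hh]; exact hs.2
      simp only [hG, hc, Nat.add_sub_cancel]
    rw [h2, intervalIntegral.integral_const, smul_eq_mul]
    push_cast
    ring
  have hlim : Tendsto (fun N => ∫ s in (0 : ℝ)..t, G N s) atTop (𝓝 (∫ s in (0 : ℝ)..t, g s)) := by
    refine intervalIntegral.tendsto_integral_filter_of_dominated_convergence (fun _ => C)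
      (Eventually.of_forall fun N => (hmeas N).aestronglyMeasurable)
      (Eventually.of_forall fun N => Eventually.of_forall fun s _ => hC _)
      intervalIntegrable_const ?_
    filter_upwards [hg] with s hs hst
    rw [Set.uIoc_of_le ht.le] at hst
    refine hs.tendsto.comp ?_
    have hz : Tendsto (fun N : ℕ => s - t / N) atTop (𝓝 s) := by
      simpa using tendsto_const_nhds.sub (tendsto_const_div_atTop_nhds_zero_nat t)
    refine tendsto_of_tendsto_of_tendsto_of_le_of_le' hz tendsto_const_nhds ?_ ?_
    all_goals
      filter_upwards [eventually_ne_atTop 0] with N hN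
      have hN' : (0 : ℝ) < N := by positivity
      have hh : 0 < t / N := by positivity
      have hpos : 0 < s / (t / N) := div_pos hst.1 hh
      have hc1 : 1 ≤ ⌈s / (t / N)⌉₊ := Nat.ceil_pos.2 hpos
      rw [Nat.cast_sub hc1, Nat.cast_one]
    · have := Nat.le_ceil (s / (t / N))
      rw [div_le_iff₀ hh] at this
      linarith
    · have := Nat.ceil_lt_add_one hpos.le
      have h3 : ((⌈s / (t / N)⌉₊ : ℝ) - 1) < s / (t / N) := by linarith
      rw [lt_div_iff₀ hh] at h3
      exact h3.le
  refine hlim.congr' ?_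
  filter_upwards [eventually_ne_atTop 0] with N hN
  exact hsum N hN

theorem eventuallyConstOnSides_of_cadlag {α : Type*} [TopologicalSpace α] [DiscreteTopology α]
    {X : ℝ≥0 → α} (hr : ∀ t, ContinuousWithinAt X (Set.Ici t) t)
    (hl : ∀ t, ∃ l, Tendsto X (𝓝[<] t) (𝓝 l)) :
    EventuallyConstOnSides fun s : ℝ => X s.toNNReal := by
  intro t
  constructor
  · refine ⟨X t.toNNReal, ?_⟩
    have h1 : Tendsto Real.toNNReal (𝓝[>] t) (𝓝[≥] t.toNNReal) := by
      refine tendsto_nhdsWithin_iff.2 ⟨continuous_real_toNNReal.continuousAt.mono_left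
        nhdsWithin_le_nhds, ?_⟩
      filter_upwards [self_mem_nhdsWithin] with s hs
      exact Real.toNNReal_mono (le_of_lt hs)
    have := (hr t.toNNReal).tendsto.comp h1
    rw [nhds_discrete, tendsto_pure] at this
    exact this
  · rcases le_or_gt t 0 with ht | ht
    · refine ⟨X 0, ?_⟩
      filter_upwards [self_mem_nhdsWithin] with s hs
      rw [Real.toNNReal_of_nonpos ((le_of_lt hs).trans ht)]
    · obtain ⟨l, hl⟩ := hl t.toNNReal
      refine ⟨l, ?_⟩
      have h1 : Tendsto Real.toNNReal (𝓝[<] t) (𝓝[<] t.toNNReal) := by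
        refine tendsto_nhdsWithin_iff.2 ⟨continuous_real_toNNReal.continuousAt.mono_left
          nhdsWithin_le_nhds, ?_⟩
        filter_upwards [self_mem_nhdsWithin] with s hs
        exact (Real.toNNReal_lt_toNNReal_iff ht).2 hs
      have := hl.comp h1
      rw [nhds_discrete, tendsto_pure] at this
      exact this

theorem EventuallyConstOnSides.comp_const_sub {α : Type*} {f : ℝ → α}
    (hf : EventuallyConstOnSides f) (c : ℝ) : EventuallyConstOnSides fun s => f (c - s) := by
  intro t
  have hcont : ∀ U : Set ℝ, Tendsto (fun s : ℝ => c - s) (𝓝[U] t) (𝓝 (c - t)) := fun U =>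
    (continuous_const.sub continuous_id).continuousAt.mono_left nhdsWithin_le_nhds
  obtain ⟨⟨a, ha⟩, ⟨b, hb⟩⟩ := hf (c - t)
  refine ⟨⟨b, ?_⟩, ⟨a, ?_⟩⟩
  · refine (tendsto_nhdsWithin_iff.2 ⟨hcont _, ?_⟩ :
      Tendsto _ (𝓝[>] t) (𝓝[<] (c - t))).eventually hb
    filter_upwards [self_mem_nhdsWithin] with s hs
    exact sub_lt_sub_left hs c
  · refine (tendsto_nhdsWithin_iff.2 ⟨hcont _, ?_⟩ :
      Tendsto _ (𝓝[<] t) (𝓝[>] (c - t))).eventually ha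
    filter_upwards [self_mem_nhdsWithin] with s hs
    exact sub_lt_sub_left hs c

theorem EventuallyConstOnSides.sum_ite_eq {α : Type*} [DecidableEq α] {κ : Type*} [Fintype κ]
    {x : ℝ → α} {y : κ → ℝ → α} (hx : EventuallyConstOnSides x)
    (hy : ∀ k, EventuallyConstOnSides (y k)) :
    EventuallyConstOnSides fun s => ∑ k, if y k s = x s then (1 : ℝ) else 0 := by
  have key : ∀ l : Filter ℝ, (∃ a, ∀ᶠ s in l, x s = a) → (∀ k, ∃ b, ∀ᶠ s in l, y k s = b) →
      ∃ c, ∀ᶠ s in l, (∑ k, if y k s = x s then (1 : ℝ) else 0) = c := by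
    rintro l ⟨a, ha⟩ h
    choose b hb using h
    refine ⟨∑ k, if b k = a then (1 : ℝ) else 0, ?_⟩
    filter_upwards [ha, eventually_all.2 hb] with s h1 h2
    simp only [h1, h2]
  exact fun t => ⟨key _ (hx t).1 fun k => (hy k t).1, key _ (hx t).2 fun k => (hy k t).2⟩

end Riemann

section Catalyst

variable {d n : ℕ} {Ω Ω' : Type*}

theorem catalyst_nonneg (Y : Fin n → ℝ≥0 → Ω → (Fin d → ℤ)) (ω : Ω) (x : Fin d → ℤ) (t : ℝ≥0) :
    0 ≤ catalyst Y ω x t := Finset.sum_nonneg fun _ _ => by split_ifs <;> norm_num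

theorem catalyst_le (Y : Fin n → ℝ≥0 → Ω → (Fin d → ℤ)) (ω : Ω) (x : Fin d → ℤ) (t : ℝ≥0) :
    catalyst Y ω x t ≤ n := by
  calc catalyst Y ω x t ≤ ∑ _k : Fin n, (1 : ℝ) :=
        Finset.sum_le_sum fun _ _ => by split_ifs <;> norm_num
    _ = n := by simp

/-- The exponent in the Feynman-Kac formula. -/
def exposure (Y : Fin n → ℝ≥0 → Ω → (Fin d → ℤ)) (X : ℝ≥0 → Ω' → (Fin d → ℤ)) (t : ℝ≥0)
    (ω : Ω) (ω' : Ω') : ℝ :=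
  ∫ s in (0 : ℝ)..t, catalyst Y ω (X s.toNNReal ω') (t - s.toNNReal)

theorem exposure_le (Y : Fin n → ℝ≥0 → Ω → (Fin d → ℤ)) (X : ℝ≥0 → Ω' → (Fin d → ℤ))
    (t : ℝ≥0) (ω : Ω) (ω' : Ω') : exposure Y X t ω ω' ≤ n * t := by
  have h := intervalIntegral.norm_integral_le_of_norm_le_const (a := 0) (b := (t : ℝ))
    (C := (n : ℝ)) (f := fun s : ℝ => catalyst Y ω (X s.toNNReal ω') (t - s.toNNReal)) fun s _ => by
      rw [Real.norm_of_nonneg (catalyst_nonneg Y ω _ _)]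
      exact catalyst_le Y ω _ _
  rw [sub_zero, abs_of_nonneg t.coe_nonneg] at h
  exact (le_abs_self _).trans h

/-- The Riemann sums of the exponent in the Feynman-Kac formula. -/
def exposureSum (Y : Fin n → ℝ≥0 → Ω → (Fin d → ℤ)) (X : ℝ≥0 → Ω' → (Fin d → ℤ)) (t : ℝ≥0)
    (N : ℕ) (ω : Ω) (ω' : Ω') : ℝ :=
  t / N * ∑ i ∈ Finset.range N, catalyst Y ω (X (i * (t / N)) ω') (t - i * (t / N))

/-- Time reversal destroys right-continuity of the walkers, but local constancy on each side
survives and makes the integrand continuous almost everywhere. -/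
theorem tendsto_exposureSum [MeasurableSpace Ω] [MeasurableSpace Ω'] {P : Measure Ω}
    {Q : Measure Ω'} {κ ρ : ℝ≥0} {x : Fin d → ℤ} {y : Fin n → Fin d → ℤ}
    {Y : Fin n → ℝ≥0 → Ω → (Fin d → ℤ)}
    {X : ℝ≥0 → Ω' → (Fin d → ℤ)} (hY : ∀ k, IsSimpleRandomWalk ρ (y k) (Y k) P)
    (hX : IsSimpleRandomWalk κ x X Q) {t : ℝ≥0} (ht : 0 < t) (ω : Ω) (ω' : Ω') :
    Tendsto (fun N => exposureSum Y X t N ω ω') atTop (𝓝 (exposure Y X t ω ω')) := by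
  set g : ℝ → ℝ := fun s =>
    ∑ k, if Y k ((t : ℝ) - s).toNNReal ω = X s.toNNReal ω' then (1 : ℝ) else 0
    with hg
  have hside : EventuallyConstOnSides g :=
    EventuallyConstOnSides.sum_ite_eq
      (eventuallyConstOnSides_of_cadlag (hX.right_continuous ω') (hX.left_limits ω'))
      fun k => (eventuallyConstOnSides_of_cadlag ((hY k).right_continuous ω)
        ((hY k).left_limits ω)).comp_const_sub t
  have hb : ∀ s, |g s| ≤ n := by
    intro s
    rw [abs_of_nonneg (Finset.sum_nonneg fun _ _ => by split_ifs <;> norm_num)]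
    calc g s ≤ ∑ _k : Fin n, (1 : ℝ) := Finset.sum_le_sum fun _ _ => by split_ifs <;> norm_num
      _ = n := by simp
  have hR := tendsto_riemann_sum hside.ae_continuousAt hb (t := (t : ℝ)) (by exact_mod_cast ht)
  have hgc : ∀ s : ℝ≥0, g s = catalyst Y ω (X s ω') (t - s) := by
    intro s
    simp only [hg, catalyst]
    refine Finset.sum_congr rfl fun k _ => ?_
    rw [Real.toNNReal_coe, NNReal.sub_def]
  have hexpo : exposure Y X t ω ω' = ∫ s in (0 : ℝ)..t, g s := by
    refine intervalIntegral.integral_congr fun s hs => ?_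
    rw [Set.uIcc_of_le t.coe_nonneg] at hs
    have := hgc s.toNNReal
    rw [Real.coe_toNNReal s hs.1] at this
    exact this.symm
  rw [hexpo]
  refine hR.congr fun N => ?_
  rw [exposureSum]
  congr 1
  refine Finset.sum_congr rfl fun i _ => ?_
  rw [← hgc]
  push_cast
  rfl

end Catalyst

end

/-! ### Increments of the joint time-reversed path -/

noncomputable section

section Skeleton

variable {d n p : ℕ} {Ω Ω' : Type*} [MeasurableSpace Ω] [MeasurableSpace Ω']
  {P : Measure Ω} {Q : Measure Ω'} {κ ρ : ℝ≥0} {x : Fin d → ℤ}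

theorem IsSimpleRandomWalk.measure_increments_eq {X : ℝ≥0 → Ω' → (Fin d → ℤ)}
    (hX : IsSimpleRandomWalk κ x X Q) (h : ℝ≥0) (N : ℕ) (c : Fin N → Fin d → ℤ) :
    Q {ω | ∀ i : Fin N, X ((i + 1 : ℕ) * h) ω - X ((i : ℕ) * h) ω = c i} =
      ∏ i, displacementLaw d κ h {c i} := by
  have hind := hX.indep_increments N (fun i => (i : ℕ) * h) (fun i j hij => by
    have : ((i : ℕ) : ℝ≥0) ≤ (j : ℕ) := by exact_mod_cast hij
    exact mul_le_mul_left this h)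
  have hset : {ω | ∀ i : Fin N, X ((i + 1 : ℕ) * h) ω - X ((i : ℕ) * h) ω = c i} =
      ⋂ i : Fin N, (fun ω => X ((i.succ : ℕ) * h) ω - X ((i.castSucc : ℕ) * h) ω) ⁻¹' {c i} := by
    ext ω
    simp
  rw [hset, hind.meas_iInter fun i => ⟨{c i}, MeasurableSet.singleton _, rfl⟩]
  refine Finset.prod_congr rfl fun i _ => ?_
  have hle : ((i.castSucc : ℕ) : ℝ≥0) * h ≤ (i.succ : ℕ) * h := by
    gcongr
    simp
  have hlaw := hX.increment_law _ _ hle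
  rw [← Measure.map_apply₀ hlaw.aemeasurable (MeasurableSet.singleton _).nullMeasurableSet,
    hlaw.map_eq]
  congr 3
  rw [← tsub_mul]
  simp

/-- Reversal permutes the independent increments and changes their sign. Carrying the negated law
along avoids proving that the step law is symmetric. -/
theorem IsSimpleRandomWalk.measure_reversed_increments_eq {Y : ℝ≥0 → Ω → (Fin d → ℤ)}
    (hY : IsSimpleRandomWalk ρ x Y P) (h : ℝ≥0) (N : ℕ) (c : Fin N → Fin d → ℤ) :
    P {ω | ∀ i : Fin N, Y (N * h - (i + 1 : ℕ) * h) ω - Y (N * h - (i : ℕ) * h) ω = c i} =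
      ∏ i, (displacementLaw d ρ h).map Neg.neg {c i} := by
  have hset : {ω | ∀ i : Fin N, Y (N * h - (i + 1 : ℕ) * h) ω - Y (N * h - (i : ℕ) * h) ω = c i} =
      {ω | ∀ i : Fin N, Y ((i + 1 : ℕ) * h) ω - Y ((i : ℕ) * h) ω = -c i.rev} := by
    ext ω
    rw [Set.mem_ofPred_eq, Set.mem_ofPred_eq, ← Fin.revPerm.forall_congr_right]
    refine forall_congr' fun i => ?_
    have h1 : (N : ℝ≥0) * h - ((i.rev : ℕ) + 1 : ℕ) * h = (i : ℕ) * h := by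
      rw [← tsub_mul, Fin.val_rev, ← Nat.cast_tsub]
      congr 2
      omega
    have h2 : (N : ℝ≥0) * h - (i.rev : ℕ) * h = (i + 1 : ℕ) * h := by
      rw [← tsub_mul, Fin.val_rev, ← Nat.cast_tsub]
      congr 2
      omega
    rw [Fin.revPerm_apply, h1, h2, ← neg_inj, neg_sub]
  rw [hset, hY.measure_increments_eq, ← Equiv.prod_comp Fin.revPerm]
  refine Finset.prod_congr rfl fun i _ => ?_
  rw [Measure.map_apply measurable_neg (MeasurableSet.singleton _)]
  congr 1
  ext a
  simp

/-- The joint path of `p` copies of the walk `X` and the time-reversed walks `Y`. -/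
def jointPath (p : ℕ) (Y : Fin n → ℝ≥0 → Ω → (Fin d → ℤ)) (X : ℝ≥0 → Ω' → (Fin d → ℤ)) (t s : ℝ≥0)
    (w : Ω × (Fin p → Ω')) : Conf (Fin p ⊕ Fin n) d :=
  Sum.elim (fun j => X s (w.2 j)) fun k => Y k (t - s) w.1

/-- The laws of the increments of the joint path over a time `h`. -/
def jointStepLaw (d p n : ℕ) (κ ρ h : ℝ≥0) : Fin p ⊕ Fin n → Measure (Fin d → ℤ) :=
  Sum.elim (fun _ => displacementLaw d κ h) fun _ => (displacementLaw d ρ h).map Neg.neg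

theorem isStepFamily_jointStepLaw (hd : 1 ≤ d) (κ ρ h : ℝ≥0) :
    IsStepFamily (twoRates p n κ ρ) h (jointStepLaw d p n κ ρ h) := by
  have hpr := isProbabilityMeasure_displacementLaw hd (t := h)
  have hneg : ∀ c : Fin d → ℤ, (Neg.neg ⁻¹' {c} : Set (Fin d → ℤ)) = {-c} := by
    intro c; ext a; simp
  have hmap : ∀ c : Fin d → ℤ, ((displacementLaw d ρ h).map Neg.neg).real {c} =
      (displacementLaw d ρ h).real {-c} := by
    intro c
    rw [measureReal_def, Measure.map_apply measurable_neg (MeasurableSet.singleton _), hneg]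
    rfl
  have h0 : ∀ r : ℝ≥0, Real.exp (-(2 * d * r * h)) ≤ (displacementLaw d r h).real {0} := by
    intro r
    have := hpr r
    rw [measureReal_def, ← ENNReal.ofReal_le_iff_le_toReal (measure_ne_top _ _)]
    exact exp_neg_le_displacementLaw_zero r h
  have h1 : ∀ (r : ℝ≥0) (i : Fin d) (c : Fin d → ℤ), (c = Pi.single i 1 ∨ c = -Pi.single i 1) →
      Real.exp (-(2 * d * r * h)) * (r * h) ≤ (displacementLaw d r h).real {c} := by
    intro r i c hc
    have := hpr r
    rw [measureReal_def, ← ENNReal.ofReal_le_iff_le_toReal (measure_ne_top _ _)]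
    exact exp_mul_le_displacementLaw_step r h i hc
  refine ⟨?_, ?_, ?_⟩
  · rintro (j | k)
    · exact hpr κ
    · have := hpr ρ
      exact Measure.isProbabilityMeasure_map measurable_neg.aemeasurable
  · rintro (j | k)
    · exact h0 κ
    · refine (h0 ρ).trans (le_of_eq ?_)
      rw [← neg_zero, ← hmap, neg_zero]
      rfl
  · rintro (j | k) i c hc
    · exact h1 κ i c hc
    · refine (h1 ρ i (-c) ?_).trans (le_of_eq (hmap c).symm)
      rcases hc with rfl | rfl
      · exact Or.inr rfl
      · exact Or.inl (neg_neg _)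

variable {Y : Fin n → ℝ≥0 → Ω → (Fin d → ℤ)} {X : ℝ≥0 → Ω' → (Fin d → ℤ)}

theorem measurable_jointPath (hY : ∀ k, IsSimpleRandomWalk ρ 0 (Y k) P)
    (hX : IsSimpleRandomWalk κ x X Q) (t s : ℝ≥0) : Measurable (jointPath p Y X t s) := by
  refine measurable_pi_iff.2 ?_
  rintro (j | k)
  · exact (hX.measurable s).comp ((measurable_pi_apply j).comp measurable_snd)
  · exact ((hY k).measurable (t - s)).comp measurable_fst

/-- The increments of the joint path over `N` time spans of length `h`. -/
def jointIncrements (p : ℕ) (Y : Fin n → ℝ≥0 → Ω → (Fin d → ℤ)) (X : ℝ≥0 → Ω' → (Fin d → ℤ))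
    (h : ℝ≥0) (N : ℕ) (w : Ω × (Fin p → Ω')) (i : Fin N) : Conf (Fin p ⊕ Fin n) d :=
  jointPath p Y X (N * h) ((i + 1 : ℕ) * h) w - jointPath p Y X (N * h) ((i : ℕ) * h) w

theorem measurable_jointIncrements (hY : ∀ k, IsSimpleRandomWalk ρ 0 (Y k) P)
    (hX : IsSimpleRandomWalk κ x X Q) (h : ℝ≥0) (N : ℕ) :
    Measurable (jointIncrements p Y X h N) :=
  measurable_pi_iff.2 fun _ => (measurable_jointPath hY hX _ _).sub (measurable_jointPath hY hX _ _)

/-- The increments of the joint path are independent and identically distributed. -/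
theorem map_jointIncrements [IsProbabilityMeasure P] [IsProbabilityMeasure Q] (hd : 1 ≤ d)
    (hY : ∀ k, IsSimpleRandomWalk ρ 0 (Y k) P) (hind : iIndepFun (fun k ω t => Y k t ω) P)
    (hX : IsSimpleRandomWalk κ x X Q) (h : ℝ≥0) (N : ℕ) :
    (P.prod (Measure.pi fun _ : Fin p => Q)).map (jointIncrements p Y X h N) =
      Measure.pi fun _ => Measure.pi (jointStepLaw d p n κ ρ h) := by
  have hprob := (isStepFamily_jointStepLaw (p := p) (n := n) hd κ ρ h).prob
  -- The space of increments is countable, so singletons suffice; their preimage factors over the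
  -- independent particles.
  refine Measure.ext_of_singleton fun c => ?_
  rw [Measure.map_apply (measurable_jointIncrements hY hX h N) (MeasurableSet.singleton _),
    Measure.pi_singleton]
  simp_rw [Measure.pi_singleton]
  rw [Finset.prod_comm, Fintype.prod_sum_type]
  have hset : jointIncrements p Y X h N ⁻¹' {c} =
      (⋂ k : Fin n, {ω | ∀ i : Fin N, Y k (N * h - (i + 1 : ℕ) * h) ω -
        Y k (N * h - (i : ℕ) * h) ω = c i (Sum.inr k)}) ×ˢ
      (Set.univ.pi fun j : Fin p => {ω' | ∀ i : Fin N, X ((i + 1 : ℕ) * h) ω' -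
        X ((i : ℕ) * h) ω' = c i (Sum.inl j)}) := by
    ext w
    simp only [Set.mem_preimage, Set.mem_singleton_iff, Set.mem_prod, Set.mem_iInter,
      Set.mem_ofPred_eq, Set.mem_pi, Set.mem_univ, true_imp_iff]
    constructor
    · rintro rfl
      exact ⟨fun k i => rfl, fun j i => rfl⟩
    · rintro ⟨h1, h2⟩
      funext i ι
      rcases ι with j | k
      · exact h2 j i
      · exact h1 k i
  rw [hset, Measure.prod_prod, Measure.pi_pi, mul_comm]
  congr 1
  · exact Finset.prod_congr rfl fun j _ => hX.measure_increments_eq h N _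
  · rw [hind.meas_iInter]
    · exact Finset.prod_congr rfl fun k _ => (hY k).measure_reversed_increments_eq h N _
    · intro k
      refine ⟨{path | ∀ i : Fin N, path (N * h - (i + 1 : ℕ) * h) -
        path (N * h - (i : ℕ) * h) = c i (Sum.inr k)}, ?_, rfl⟩
      rw [Set.ofPred_forall]
      refine MeasurableSet.iInter fun i => ?_
      have hm : Measurable fun path : ℝ≥0 → Fin d → ℤ =>
          path (N * h - (i + 1 : ℕ) * h) - path (N * h - (i : ℕ) * h) :=
        (measurable_pi_apply _).sub (measurable_pi_apply _)
      exact hm (MeasurableSet.singleton _)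

theorem partialSum_sub {S : Type*} [AddCommGroup S] {N : ℕ} (a : ℕ → S) (i : Fin N) :
    partialSum (fun l : Fin N => a (l + 1) - a l) i = a i - a 0 := by
  unfold partialSum
  have h := Fin.sum_univ_eq_sum_range (fun l : ℕ => if l < (i : ℕ) then a (l + 1) - a l else 0) N
  simp only [Fin.lt_def]
  rw [h, ← Finset.sum_filter, ← Finset.sum_range_sub]
  congr 1
  ext l
  simp
  omega

theorem sum_fin_sub {S : Type*} [AddCommGroup S] (N : ℕ) (a : ℕ → S) :
    ∑ l : Fin N, (a (l + 1) - a l) = a N - a 0 := by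
  rw [Fin.sum_univ_eq_sum_range (fun l : ℕ => a (l + 1) - a l) N, Finset.sum_range_sub]

end Skeleton

end

/-! ### The Feynman-Kac formula for the moments -/

noncomputable section

section FeynmanKac

open L2

variable {d n p : ℕ} {Ω Ω' : Type*} [MeasurableSpace Ω] [MeasurableSpace Ω']
  {P : Measure Ω} {Q : Measure Ω'} {κ ρ : ℝ≥0} {x : Fin d → ℤ}
  {Y : Fin n → ℝ≥0 → Ω → (Fin d → ℤ)} {X : ℝ≥0 → Ω' → (Fin d → ℤ)}

/-- The total exponent in the `p`-th power of the Feynman-Kac formula. -/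
def totalExposure (p : ℕ) (Y : Fin n → ℝ≥0 → Ω → (Fin d → ℤ)) (X : ℝ≥0 → Ω' → (Fin d → ℤ)) (t : ℝ≥0)
    (w : Ω × (Fin p → Ω')) : ℝ := ∑ j, exposure Y X t w.1 (w.2 j)

theorem totalExposure_le (t : ℝ≥0) (w : Ω × (Fin p → Ω')) :
    totalExposure p Y X t w ≤ p * (n * t) := by
  refine (Finset.sum_le_sum fun j _ => exposure_le Y X t w.1 (w.2 j)).trans ?_
  simp

/-- The displacement of the joint path over the whole time interval. -/
def jointDisplacement (p : ℕ) (Y : Fin n → ℝ≥0 → Ω → (Fin d → ℤ)) (X : ℝ≥0 → Ω' → (Fin d → ℤ))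
    (t : ℝ≥0) (w : Ω × (Fin p → Ω')) : Conf (Fin p ⊕ Fin n) d :=
  jointPath p Y X t t w - jointPath p Y X t 0 w

theorem measurable_jointDisplacement (hY : ∀ k, IsSimpleRandomWalk ρ 0 (Y k) P)
    (hX : IsSimpleRandomWalk κ x X Q) (t : ℝ≥0) : Measurable (jointDisplacement p Y X t) :=
  (measurable_jointPath hY hX _ _).sub (measurable_jointPath hY hX _ _)

/-- The initial configuration of the joint path, if its displacement is `c`. -/
def initialConf (x : Fin d → ℤ) (c : Conf (Fin p ⊕ Fin n) d) : Conf (Fin p ⊕ Fin n) d :=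
  Sum.elim (fun _ => x) fun k => -c (Sum.inr k)

/-- A reversed walker ends at the origin, so it starts at minus its displacement. -/
theorem jointPath_zero (hY : ∀ k, IsSimpleRandomWalk ρ 0 (Y k) P)
    (hX : IsSimpleRandomWalk κ x X Q) (t : ℝ≥0) (w : Ω × (Fin p → Ω')) :
    jointPath p Y X t 0 w = initialConf x (jointDisplacement p Y X t w) := by
  funext ι
  rcases ι with j | k
  · exact hX.start _
  · simp [jointPath, initialConf, jointDisplacement, (hY k).start]

theorem contacts_jointPath (t s : ℝ≥0) (w : Ω × (Fin p → Ω')) :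
    contacts Sum.isLeft (jointPath p Y X t s w) = ∑ j, catalyst Y w.1 (X s (w.2 j)) (t - s) := by
  simp only [contacts, jointPath, catalyst, Fintype.sum_sum_type, Sum.isLeft_inl, Sum.isLeft_inr,
    Sum.elim_inl, Sum.elim_inr, true_and, Bool.true_eq_false, Bool.false_eq_true, false_and,
    if_false, Finset.sum_const_zero, zero_add, add_zero]
  exact Finset.sum_congr rfl fun j _ => Finset.sum_congr rfl fun k _ => by
    simp only [eq_comm (a := X s (w.2 j))]

theorem sum_jointIncrements (h : ℝ≥0) (N : ℕ) (w : Ω × (Fin p → Ω')) :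
    ∑ i, jointIncrements p Y X h N w i = jointDisplacement p Y X (N * h) w := by
  have := sum_fin_sub N fun l : ℕ => jointPath p Y X (N * h) (l * h) w
  simpa [jointIncrements, jointDisplacement] using this

theorem jointPath_eq_partialSum (h : ℝ≥0) (N : ℕ) (w : Ω × (Fin p → Ω')) (i : Fin N) :
    jointPath p Y X (N * h) ((i : ℕ) * h) w =
      jointPath p Y X (N * h) 0 w + partialSum (jointIncrements p Y X h N w) i := by
  have := partialSum_sub (N := N) (fun l : ℕ => jointPath p Y X (N * h) (l * h) w) i
  simp only [Nat.cast_zero, zero_mul] at this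
  rw [← sub_eq_iff_eq_add', ← this]
  rfl

theorem measurable_exposureSum (hY : ∀ k, IsSimpleRandomWalk ρ 0 (Y k) P)
    (hX : IsSimpleRandomWalk κ x X Q) (t : ℝ≥0) (N : ℕ) :
    Measurable fun w : Ω × Ω' => exposureSum Y X t N w.1 w.2 := by
  refine (Finset.measurable_fun_sum _ fun i _ => Finset.measurable_fun_sum _ fun k _ =>
    Measurable.ite (measurableSet_eq_fun (((hY k).measurable _).comp measurable_fst)
      ((hX.measurable _).comp measurable_snd)) measurable_const measurable_const).const_mul _

theorem measurable_exposure (hY : ∀ k, IsSimpleRandomWalk ρ 0 (Y k) P)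
    (hX : IsSimpleRandomWalk κ x X Q) {t : ℝ≥0} (ht : 0 < t) :
    Measurable fun w : Ω × Ω' => exposure Y X t w.1 w.2 :=
  measurable_of_tendsto_metrizable (fun N => measurable_exposureSum hY hX t N)
    (tendsto_pi_nhds.2 fun w => tendsto_exposureSum hY hX ht w.1 w.2)

theorem measurable_sum_apply {F : Ω × Ω' → ℝ} (hF : Measurable F) :
    Measurable fun w : Ω × (Fin p → Ω') => ∑ j, F (w.1, w.2 j) :=
  Finset.measurable_fun_sum _ fun j _ => hF.comp
    (measurable_fst.prodMk ((measurable_pi_apply j).comp measurable_snd))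

theorem measurable_totalExposure (hY : ∀ k, IsSimpleRandomWalk ρ 0 (Y k) P)
    (hX : IsSimpleRandomWalk κ x X Q) {t : ℝ≥0} (ht : 0 < t) :
    Measurable (totalExposure p Y X t) :=
  measurable_sum_apply (measurable_exposure hY hX ht)

theorem exposureSum_le (t : ℝ≥0) (N : ℕ) (ω : Ω) (ω' : Ω') :
    exposureSum Y X t N ω ω' ≤ n * t := by
  rcases eq_or_ne N 0 with rfl | hN
  · simp only [exposureSum, Finset.range_zero, Finset.sum_empty, mul_zero]
    positivity
  calc exposureSum Y X t N ω ω' ≤ t / N * ∑ _i ∈ Finset.range N, (n : ℝ) := by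
        unfold exposureSum
        gcongr
        exact catalyst_le _ _ _ _
    _ = n * t := by
        have : (N : ℝ) ≠ 0 := by exact_mod_cast hN
        simp
        field_simp

/-- The discretized Feynman-Kac formula for the joint path. -/
theorem integral_exp_exposureSum [IsProbabilityMeasure P] [IsProbabilityMeasure Q] (hd : 1 ≤ d)
    (hY : ∀ k, IsSimpleRandomWalk ρ 0 (Y k) P) (hind : iIndepFun (fun k ω t => Y k t ω) P)
    (hX : IsSimpleRandomWalk κ x X Q) (t : ℝ≥0) {N : ℕ} (hN : N ≠ 0)
    (c : Conf (Fin p ⊕ Fin n) d) :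
    ∫ w, Real.exp (∑ j, exposureSum Y X t N w.1 (w.2 j)) *
        (if jointDisplacement p Y X t w = c then 1 else 0)
        ∂(P.prod (Measure.pi fun _ : Fin p => Q)) =
      (stepOp Sum.isLeft (t / N) (Measure.pi (jointStepLaw d p n κ ρ (t / N))) ^ N)
        (delta (initialConf x c + c)) (initialConf x c) := by
  have hprob := (isStepFamily_jointStepLaw (p := p) (n := n) hd κ ρ (t / N)).prob
  have hNh : (N : ℝ≥0) * (t / N) = t := by
    rw [mul_div_cancel₀]; exact_mod_cast hN
  have hcast : ((t / N : ℝ≥0) : ℝ) = (t : ℝ) / N := by push_cast; rfl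
  rw [stepOp_pow_apply, ← map_jointIncrements hd hY hind hX,
    integral_map (measurable_jointIncrements hY hX _ _).aemeasurable
      Measurable.of_discrete.aestronglyMeasurable]
  refine integral_congr_ae (Eventually.of_forall fun w => ?_)
  simp only [delta_apply, add_right_inj]
  rw [sum_jointIncrements, hNh]
  split_ifs with hc
  · simp only [mul_one]
    congr 1
    simp only [exposureSum]
    rw [← Finset.mul_sum, Finset.sum_comm]
    congr 1
    rw [← Fin.sum_univ_eq_sum_range
      (fun i : ℕ => ∑ j, catalyst Y w.1 (X (i * (t / N)) (w.2 j)) (t - i * (t / N))) N]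
    refine Finset.sum_congr rfl fun i _ => ?_
    have hpath := jointPath_eq_partialSum (p := p) (Y := Y) (X := X) (t / N) N w i
    -- On the event that the displacement is `c` the initial configuration is deterministic, so the
    -- path is a fixed start plus partial sums of the increments.
    rw [hNh, jointPath_zero hY hX, hc] at hpath
    rw [← hpath, contacts_jointPath]
  · simp

/-- The Feynman-Kac formula for the joint path. -/
theorem integral_exp_totalExposure [IsProbabilityMeasure P] [IsProbabilityMeasure Q] (hd : 1 ≤ d)
    (hY : ∀ k, IsSimpleRandomWalk ρ 0 (Y k) P) (hind : iIndepFun (fun k ω t => Y k t ω) P)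
    (hX : IsSimpleRandomWalk κ x X Q) {t : ℝ≥0} (ht : 0 < t) (c : Conf (Fin p ⊕ Fin n) d) :
    ∫ w, Real.exp (totalExposure p Y X t w) *
        (if jointDisplacement p Y X t w = c then 1 else 0)
        ∂(P.prod (Measure.pi fun _ : Fin p => Q)) =
      kernelFK Sum.isLeft (twoRates p n κ ρ) t (initialConf x c) (initialConf x c + c) := by
  have hlim1 : Tendsto (fun N : ℕ => ∫ w, Real.exp (∑ j, exposureSum Y X t N w.1 (w.2 j)) *
        (if jointDisplacement p Y X t w = c then 1 else 0)
        ∂(P.prod (Measure.pi fun _ : Fin p => Q))) atTop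
      (𝓝 (∫ w, Real.exp (totalExposure p Y X t w) *
        (if jointDisplacement p Y X t w = c then 1 else 0)
        ∂(P.prod (Measure.pi fun _ : Fin p => Q)))) := by
    refine tendsto_integral_of_dominated_convergence (fun _ => Real.exp (p * (n * t))) ?_
      (integrable_const _) ?_ ?_
    · intro N
      refine Measurable.aestronglyMeasurable ?_
      refine Measurable.mul (Real.measurable_exp.comp
        (measurable_sum_apply (measurable_exposureSum hY hX t N))) ?_
      exact Measurable.ite (measurable_jointDisplacement hY hX t (MeasurableSet.singleton c))
        measurable_const measurable_const
    · intro N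
      refine Eventually.of_forall fun w => ?_
      rw [norm_mul, Real.norm_eq_abs, Real.abs_exp]
      refine (mul_le_of_le_one_right (Real.exp_pos _).le
        (by split_ifs <;> simp)).trans (Real.exp_le_exp.2 ?_)
      refine (Finset.sum_le_sum fun j _ => exposureSum_le t N w.1 (w.2 j)).trans ?_
      simp
    · refine Eventually.of_forall fun w => Tendsto.mul_const _ ?_
      have hsum : Tendsto (fun N => ∑ j, exposureSum Y X t N w.1 (w.2 j)) atTop
          (𝓝 (totalExposure p Y X t w)) :=
        tendsto_finsetSum _ fun j _ => tendsto_exposureSum hY hX ht w.1 (w.2 j)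
      exact hsum.rexp
  have hlim2 := tendsto_stepOp_pow Sum.isLeft t
    (fun N : ℕ => jointStepLaw d p n κ ρ (t / N)) fun N => isStepFamily_jointStepLaw hd κ ρ (t / N)
  have hlim3 := (((evalCLM (initialConf x c)).comp (ContinuousLinearMap.apply ℝ _
    (delta (initialConf x c + c)))).continuous.tendsto _).comp hlim2
  refine tendsto_nhds_unique hlim1 (Tendsto.congr' ?_ hlim3)
  filter_upwards [eventually_ne_atTop 0] with N hN
  exact (integral_exp_exposureSum hd hY hind hX t hN c).symm

/-- The `p`-th moment of the Feynman-Kac solution as an expectation over `p` copies of the walk. -/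
theorem integral_pamSolution_pow [IsProbabilityMeasure P] [IsProbabilityMeasure Q]
    (hY : ∀ k, IsSimpleRandomWalk ρ 0 (Y k) P)
    (hX : IsSimpleRandomWalk κ x X Q) {t : ℝ≥0} (ht : 0 < t) :
    ∫ ω, pamSolution Y X Q t ω ^ p ∂P = ∫ w, Real.exp (totalExposure p Y X t w)
      ∂(P.prod (Measure.pi fun _ : Fin p => Q)) := by
  rw [integral_prod]
  · refine integral_congr_ae (Eventually.of_forall fun ω => ?_)
    simp only [totalExposure, Real.exp_sum]
    have := integral_fintype_prod_eq_pow (𝕜 := ℝ) (ι := Fin p) (μ := Q)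
      (f := fun ω' => Real.exp (exposure Y X t ω ω'))
    rw [Fintype.card_fin] at this
    exact this.symm
  · refine Integrable.of_bound
      (Real.measurable_exp.comp (measurable_totalExposure hY hX ht)).aestronglyMeasurable
      (Real.exp (p * (n * t))) (Eventually.of_forall fun w => ?_)
    rw [Real.norm_eq_abs, Real.abs_exp]
    exact Real.exp_le_exp.2 (totalExposure_le t w)

theorem map_jointDisplacement [IsProbabilityMeasure P] [IsProbabilityMeasure Q] (hd : 1 ≤ d)
    (hY : ∀ k, IsSimpleRandomWalk ρ 0 (Y k) P) (hind : iIndepFun (fun k ω t => Y k t ω) P)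
    (hX : IsSimpleRandomWalk κ x X Q) (t : ℝ≥0) :
    (P.prod (Measure.pi fun _ : Fin p => Q)).map (jointDisplacement p Y X t) =
      Measure.pi (jointStepLaw d p n κ ρ t) := by
  have hprob := (isStepFamily_jointStepLaw (p := p) (n := n) hd κ ρ t).prob
  have h := map_jointIncrements (p := p) hd hY hind hX t 1
  have h2 : jointDisplacement p Y X t = (fun c : Fin 1 → Conf (Fin p ⊕ Fin n) d => c 0) ∘
      jointIncrements p Y X t 1 := by
    funext w
    have := sum_jointIncrements (p := p) (Y := Y) (X := X) t 1 w
    simpa using this.symm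
  rw [h2, ← Measure.map_map (measurable_pi_apply 0) (measurable_jointIncrements hY hX t 1), h]
  exact (measurePreserving_eval (fun _ : Fin 1 => Measure.pi (jointStepLaw d p n κ ρ t)) 0).map_eq

end FeynmanKac

end

/-! ### Growth of the moments -/

noncomputable section

section Moments

open L2

variable {d n p : ℕ} {Ω Ω' : Type*} [MeasurableSpace Ω] [MeasurableSpace Ω']
  {P : Measure Ω} {Q : Measure Ω'} {κ ρ : ℝ≥0} {x : Fin d → ℤ}
  {Y : Fin n → ℝ≥0 → Ω → (Fin d → ℤ)} {X : ℝ≥0 → Ω' → (Fin d → ℤ)}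

/-- The configurations whose coordinates are all bounded by `R`. -/
def confBox (I : Type*) [Fintype I] [DecidableEq I] (d R : ℕ) : Finset (Conf I d) :=
  Fintype.piFinset fun _ => Fintype.piFinset fun _ => Finset.Icc (-(R : ℤ)) R

theorem card_confBox (I : Type*) [Fintype I] [DecidableEq I] (d R : ℕ) :
    (confBox I d R).card = (2 * R + 1) ^ (d * Fintype.card I) := by
  have : ((R : ℤ) + 1 + R).toNat = 2 * R + 1 := by omega
  simp [confBox, Fintype.card_piFinset, this, pow_mul]

theorem exists_norm_gt_of_notMem_confBox {I : Type*} [Fintype I] [DecidableEq I] {R : ℕ}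
    {c : Conf I d} (hc : c ∉ confBox I d R) : ∃ ι, (R : ℝ) < ‖c ι‖ := by
  simp only [confBox, Fintype.mem_piFinset, not_forall] at hc
  obtain ⟨ι, i, h⟩ := hc
  refine ⟨ι, lt_of_lt_of_le ?_ (norm_le_pi_norm (c ι) i)⟩
  rw [Int.norm_eq_abs, ← Int.cast_abs]
  rw [Finset.mem_Icc, ← abs_le, not_le] at h
  exact_mod_cast h

theorem integrable_exp_totalExposure_mul [IsProbabilityMeasure P] [IsProbabilityMeasure Q]
    (hY : ∀ k, IsSimpleRandomWalk ρ 0 (Y k) P) (hX : IsSimpleRandomWalk κ x X Q) {t : ℝ≥0}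
    (ht : 0 < t) (A : Set (Conf (Fin p ⊕ Fin n) d)) [DecidablePred (· ∈ A)] :
    Integrable (fun w => Real.exp (totalExposure p Y X t w) *
      if jointDisplacement p Y X t w ∈ A then 1 else 0)
      (P.prod (Measure.pi fun _ : Fin p => Q)) := by
  refine Integrable.of_bound (C := Real.exp (p * (n * t))) (Measurable.aestronglyMeasurable
    ((Real.measurable_exp.comp (measurable_totalExposure hY hX ht)).mul (Measurable.ite
      (measurable_jointDisplacement hY hX t MeasurableSet.of_discrete)
      measurable_const measurable_const))) (Eventually.of_forall fun w => ?_)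
  rw [norm_mul, Real.norm_eq_abs, Real.abs_exp]
  exact (mul_le_of_le_one_right (Real.exp_pos _).le (by split_ifs <;> simp)).trans
    (Real.exp_le_exp.2 (totalExposure_le t w))

/-- Only displacement zero is kept; the joint path then begins and ends in the starting
configuration. -/
theorem kernelFK_le_moment [IsProbabilityMeasure P] [IsProbabilityMeasure Q] (hd : 1 ≤ d)
    (hY : ∀ k, IsSimpleRandomWalk ρ 0 (Y k) P) (hind : iIndepFun (fun k ω t => Y k t ω) P)
    (hX : IsSimpleRandomWalk κ x X Q) {t : ℝ≥0} (ht : 0 < t) :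
    kernelFK Sum.isLeft (twoRates p n κ ρ) t (startConf p n x) (startConf p n x) ≤
      ∫ w, Real.exp (totalExposure p Y X t w) ∂(P.prod (Measure.pi fun _ : Fin p => Q)) := by
  have h := integral_exp_totalExposure (p := p) hd hY hind hX ht 0
  have hz : initialConf x (0 : Conf (Fin p ⊕ Fin n) d) = startConf p n x := by
    funext ι; cases ι <;> simp [initialConf, startConf]
  rw [add_zero, hz] at h
  rw [← h]
  refine integral_mono (integrable_exp_totalExposure_mul hY hX ht {0}) ?_ fun w => ?_
  · simpa using integrable_exp_totalExposure_mul (p := p) hY hX ht Set.univ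
  · exact mul_le_of_le_one_right (Real.exp_pos _).le (by split_ifs <;> simp)

/-- A union bound over the `p + n` particles; the rate `κ + ρ` dominates both rates. -/
theorem measure_jointDisplacement_notMem_le [IsProbabilityMeasure P] [IsProbabilityMeasure Q]
    (hd : 1 ≤ d) (hY : ∀ k, IsSimpleRandomWalk ρ 0 (Y k) P)
    (hind : iIndepFun (fun k ω t => Y k t ω) P) (hX : IsSimpleRandomWalk κ x X Q) (t : ℝ≥0)
    (R : ℕ) :
    (P.prod (Measure.pi fun _ : Fin p => Q)).real
        {w | jointDisplacement p Y X t w ∉ confBox (Fin p ⊕ Fin n) d R} ≤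
      (p + n) * Real.exp (2 * d * (κ + ρ) * t * (Real.exp 1 - 1) - R) := by
  have hprob := (isStepFamily_jointStepLaw (p := p) (n := n) hd κ ρ t).prob
  set B : ℝ := Real.exp (2 * d * (κ + ρ) * t * (Real.exp 1 - 1) - R) with hB
  have he : (0 : ℝ) ≤ Real.exp 1 - 1 := by
    have := Real.add_one_le_exp (1 : ℝ)
    linarith
  have hone : ∀ r : ℝ≥0, r ≤ κ + ρ →
      displacementLaw d r t {z | (R : ℝ) < ‖z‖} ≤ ENNReal.ofReal B := by
    intro r hr
    refine (displacementLaw_norm_gt_le hd r t R).trans (ENNReal.ofReal_le_ofReal ?_)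
    have hr' : (r : ℝ) ≤ κ + ρ := by exact_mod_cast hr
    rw [hB]
    gcongr
  have hlaw : ∀ ι, jointStepLaw d p n κ ρ t ι {z | (R : ℝ) < ‖z‖} ≤ ENNReal.ofReal B := by
    rintro (j | k)
    · exact hone κ le_self_add
    · have hpre : (Neg.neg ⁻¹' {z : Fin d → ℤ | (R : ℝ) < ‖z‖}) = {z | (R : ℝ) < ‖z‖} := by
        ext z; simp
      change (displacementLaw d ρ t).map Neg.neg _ ≤ _
      rw [Measure.map_apply measurable_neg MeasurableSet.of_discrete, hpre]
      exact hone ρ le_add_self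
  have hmain : (P.prod (Measure.pi fun _ : Fin p => Q))
      {w | jointDisplacement p Y X t w ∉ confBox (Fin p ⊕ Fin n) d R} ≤
      ENNReal.ofReal ((p + n) * B) := by
    calc _ = (P.prod (Measure.pi fun _ : Fin p => Q)).map (jointDisplacement p Y X t)
          {c | c ∉ confBox (Fin p ⊕ Fin n) d R} := by
          rw [Measure.map_apply (measurable_jointDisplacement hY hX t) MeasurableSet.of_discrete]
          rfl
      _ ≤ Measure.pi (jointStepLaw d p n κ ρ t) (⋃ ι, Function.eval ι ⁻¹' {z | (R : ℝ) < ‖z‖}) := by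
          rw [map_jointDisplacement hd hY hind hX]
          refine measure_mono fun c hc => ?_
          obtain ⟨ι, hι⟩ := exists_norm_gt_of_notMem_confBox hc
          exact Set.mem_iUnion.2 ⟨ι, hι⟩
      _ ≤ ∑ ι, Measure.pi (jointStepLaw d p n κ ρ t)
            (Function.eval ι ⁻¹' {z | (R : ℝ) < ‖z‖}) := measure_iUnion_fintype_le _ _
      _ ≤ ∑ _ι : Fin p ⊕ Fin n, ENNReal.ofReal B := by
          refine Finset.sum_le_sum fun ι _ => ?_
          rw [(measurePreserving_eval _ ι).measure_preimage
            MeasurableSet.of_discrete.nullMeasurableSet]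
          exact hlaw ι
      _ = _ := by
          rw [Finset.sum_const, Finset.card_univ, Fintype.card_sum, Fintype.card_fin,
            Fintype.card_fin, nsmul_eq_mul, ENNReal.ofReal_mul (by positivity)]
          congr 1
          rw [← Nat.cast_add, ENNReal.ofReal_natCast]
  rw [measureReal_def]
  exact ENNReal.toReal_le_of_le_ofReal (by positivity) hmain

/-- Each displacement in the box contributes a kernel entry, at most exp(tE). Outside it, the
exponent is bounded by its maximum `p * n * t` and the tail probability is used. -/
theorem moment_le [IsProbabilityMeasure P] [IsProbabilityMeasure Q] (hd : 1 ≤ d)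
    (hY : ∀ k, IsSimpleRandomWalk ρ 0 (Y k) P) (hind : iIndepFun (fun k ω t => Y k t ω) P)
    (hX : IsSimpleRandomWalk κ x X Q) {t : ℝ≥0} (ht : 0 < t) (R : ℕ) :
    ∫ w, Real.exp (totalExposure p Y X t w) ∂(P.prod (Measure.pi fun _ : Fin p => Q)) ≤
      (2 * R + 1) ^ (d * (p + n)) * Real.exp (t * twoRateEnergy d p n (κ, ρ)) +
      Real.exp (p * (n * t)) *
        ((p + n) * Real.exp (2 * d * (κ + ρ) * t * (Real.exp 1 - 1) - R)) := by
  classical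
  set μ := P.prod (Measure.pi fun _ : Fin p => Q)
  set box := confBox (Fin p ⊕ Fin n) d R
  have hpt : ∀ w, Real.exp (totalExposure p Y X t w) ≤
      (∑ c ∈ box, Real.exp (totalExposure p Y X t w) *
        (if jointDisplacement p Y X t w = c then 1 else 0)) +
      Real.exp (p * (n * t)) *
        {w | jointDisplacement p Y X t w ∉ box}.indicator (fun _ => (1 : ℝ)) w := by
    intro w
    by_cases hw : jointDisplacement p Y X t w ∈ box
    · rw [← Finset.mul_sum, Finset.sum_ite_eq, if_pos hw,
        Set.indicator_of_notMem (by simpa using hw)]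
      simp
    · rw [← Finset.mul_sum, Finset.sum_ite_eq, if_neg hw, Set.indicator_of_mem (by simpa using hw)]
      simpa using totalExposure_le t w
  have hmeas : MeasurableSet {w | jointDisplacement p Y X t w ∉ box} :=
    measurable_jointDisplacement hY hX t (MeasurableSet.of_discrete (s := {c | c ∉ box}))
  have hi1 : ∀ c ∈ box, Integrable (fun w => Real.exp (totalExposure p Y X t w) *
      (if jointDisplacement p Y X t w = c then 1 else 0)) μ := fun c _ =>
    integrable_exp_totalExposure_mul hY hX ht {c}
  have hi2 : Integrable (fun w => Real.exp (p * (n * t)) *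
      {w | jointDisplacement p Y X t w ∉ box}.indicator (fun _ => (1 : ℝ)) w) μ :=
    ((integrable_const 1).indicator hmeas).const_mul _
  have hi0 : Integrable (fun w => Real.exp (totalExposure p Y X t w)) μ := by
    simpa using integrable_exp_totalExposure_mul (p := p) hY hX ht Set.univ
  refine (integral_mono hi0 ((integrable_finsetSum _ hi1).add hi2) hpt).trans ?_
  rw [integral_add' (integrable_finsetSum _ hi1) hi2, integral_finsetSum _ hi1,
    integral_const_mul, integral_indicator_const _ hmeas, smul_eq_mul, mul_one]
  refine add_le_add ?_ ?_
  · calc _ = ∑ c ∈ box, kernelFK Sum.isLeft (twoRates p n κ ρ) t (initialConf x c)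
            (initialConf x c + c) :=
          Finset.sum_congr rfl fun c _ => integral_exp_totalExposure hd hY hind hX ht c
      _ ≤ ∑ _c ∈ box, Real.exp (t * twoRateEnergy d p n (κ, ρ)) :=
          Finset.sum_le_sum fun c _ => kernelFK_le _ _ t.coe_nonneg _ _
      _ = _ := by
          rw [Finset.sum_const, card_confBox, nsmul_eq_mul, Fintype.card_sum, Fintype.card_fin,
            Fintype.card_fin]
          push_cast
          rfl
  · gcongr
    exact measure_jointDisplacement_notMem_le hd hY hind hX t R

/-- The moments grow at most like a polynomial times the exponential of the top energy. -/
theorem exists_moment_le [IsProbabilityMeasure P] [IsProbabilityMeasure Q] (hd : 1 ≤ d)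
    (hY : ∀ k, IsSimpleRandomWalk ρ 0 (Y k) P) (hind : iIndepFun (fun k ω t => Y k t ω) P)
    (hX : IsSimpleRandomWalk κ x X Q) :
    ∃ K > 0, ∃ m : ℕ, ∀ t : ℝ≥0, 1 ≤ t →
      ∫ w, Real.exp (totalExposure p Y X t w) ∂(P.prod (Measure.pi fun _ : Fin p => Q)) ≤
        (K * t) ^ m * Real.exp (t * twoRateEnergy d p n (κ, ρ)) := by
  set E := twoRateEnergy d p n (κ, ρ)
  have he : (0 : ℝ) ≤ Real.exp 1 - 1 := by
    have := Real.add_one_le_exp (1 : ℝ)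
    linarith
  -- With `R ≥ t * B` the tail exponent is at most -t|E|, hence at most tE. Also `R ≤ t * B + 1`,
  -- which gives the linear bound with constant `2 * B + 3 + (p + n)` for `t ≥ 1`.
  set B : ℝ := p * n + 2 * d * (κ + ρ) * (Real.exp 1 - 1) + |E| with hB
  have hB0 : 0 ≤ B := by positivity
  refine ⟨2 * B + 3 + (p + n), by positivity, d * (p + n) + 1, fun t ht => ?_⟩
  have ht' : (1 : ℝ) ≤ t := by exact_mod_cast ht
  have hR1 := Nat.le_ceil (t * B)
  have hR2 := Nat.ceil_lt_add_one (by positivity : (0 : ℝ) ≤ t * B)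
  refine (moment_le hd hY hind hX (zero_lt_one.trans_le ht) ⌈(t : ℝ) * B⌉₊).trans ?_
  set R : ℝ := (⌈(t : ℝ) * B⌉₊ : ℝ) with hR
  have hexp : Real.exp (p * (n * t)) *
      ((p + n) * Real.exp (2 * d * (κ + ρ) * t * (Real.exp 1 - 1) - R)) ≤
      (p + n) * Real.exp (t * E) := by
    rw [mul_left_comm, ← Real.exp_add]
    gcongr
    have h1 : -(t * |E|) ≤ t * E := by
      have := mul_le_mul_of_nonneg_left (neg_abs_le E) t.coe_nonneg
      linarith
    have h2 : t * B = p * (n * t) + 2 * d * (κ + ρ) * t * (Real.exp 1 - 1) + t * |E| := by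
      rw [hB]; ring
    linarith
  have hR0 : 0 ≤ R := Nat.cast_nonneg _
  set a : ℝ := 2 * R + 1 with ha
  set M : ℝ := p + n with hM
  have hM0 : 0 ≤ M := by positivity
  have ha1 : 1 ≤ a := by linarith
  -- The extra power absorbs the tail constant `M` into a single monomial.
  have hpoly : a ^ (d * (p + n)) + M ≤ (a + M) ^ (d * (p + n) + 1) := by
    have h1 : a ^ (d * (p + n)) ≤ (a + M) ^ (d * (p + n)) := by gcongr; linarith
    have h2 : 1 ≤ (a + M) ^ (d * (p + n)) := one_le_pow₀ (by linarith)
    rw [pow_succ]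
    nlinarith
  have hle : a + M ≤ (2 * B + 3 + M) * t := by
    have h3 : 0 ≤ (3 + M) * (t - 1) := mul_nonneg (by positivity) (by linarith)
    nlinarith
  calc _ ≤ a ^ (d * (p + n)) * Real.exp (t * E) + M * Real.exp (t * E) := by gcongr
    _ = (a ^ (d * (p + n)) + M) * Real.exp (t * E) := by ring
    _ ≤ _ := by
      gcongr
      exact hpoly.trans (by gcongr)

theorem tendsto_log_div_of_bounds {W : ℝ≥0 → ℝ} {E : ℝ}
    (hlow : ∀ ν < E, ∃ C > 0, ∀ t : ℝ≥0, 2 ≤ t → C * Real.exp (t * ν) ≤ W t)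
    (hup : ∃ K > 0, ∃ m : ℕ, ∀ t : ℝ≥0, 1 ≤ t → W t ≤ (K * t) ^ m * Real.exp (t * E)) :
    Tendsto (fun t : ℝ≥0 => Real.log (W t) / t) atTop (𝓝 E) := by
  have hcoe : Tendsto (fun t : ℝ≥0 => (t : ℝ)) atTop atTop := NNReal.tendsto_coe_atTop.2 tendsto_id
  have hconst : ∀ c : ℝ, Tendsto (fun t : ℝ≥0 => c / (t : ℝ)) atTop (𝓝 0) := fun c =>
    hcoe.const_div_atTop c
  have hpos : ∀ᶠ t : ℝ≥0 in atTop, 0 < W t := by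
    obtain ⟨C, hC, h⟩ := hlow (E - 1) (by linarith)
    filter_upwards [eventually_ge_atTop 2] with t ht
    exact lt_of_lt_of_le (by positivity) (h t ht)
  refine tendsto_order.2 ⟨fun a ha => ?_, fun a ha => ?_⟩
  · obtain ⟨ν, haν, hνE⟩ := exists_between ha
    obtain ⟨C, hC, h⟩ := hlow ν hνE
    have hlim : Tendsto (fun t : ℝ≥0 => Real.log C / (t : ℝ) + ν) atTop (𝓝 (0 + ν)) :=
      (hconst _).add_const ν
    rw [zero_add] at hlim
    filter_upwards [hlim.eventually (lt_mem_nhds haν), eventually_ge_atTop 2] with t ht ht2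
    refine ht.trans_le ?_
    have ht0 : (0 : ℝ) < t := by
      have : (2 : ℝ) ≤ t := by exact_mod_cast ht2
      linarith
    have hl := Real.log_le_log (by positivity) (h t ht2)
    rw [Real.log_mul hC.ne' (Real.exp_pos _).ne', Real.log_exp] at hl
    rw [le_div_iff₀ ht0, add_mul, div_mul_cancel₀ _ ht0.ne']
    linarith
  · obtain ⟨K, hK, m, h⟩ := hup
    have hlog : Tendsto (fun t : ℝ≥0 => Real.log t / (t : ℝ)) atTop (𝓝 0) :=
      (Real.isLittleO_log_id_atTop.tendsto_div_nhds_zero).comp hcoe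
    have hlim : Tendsto (fun t : ℝ≥0 => m * (Real.log K / (t : ℝ) + Real.log t / t) + E) atTop
        (𝓝 (m * (0 + 0) + E)) := (((hconst _).add hlog).const_mul _).add_const E
    rw [add_zero, mul_zero, zero_add] at hlim
    filter_upwards [hlim.eventually (gt_mem_nhds ha), eventually_ge_atTop 1, hpos] with t ht ht1 hW
    refine lt_of_le_of_lt ?_ ht
    have ht0 : (0 : ℝ) < t := by
      have : (1 : ℝ) ≤ t := by exact_mod_cast ht1
      linarith
    have hl := Real.log_le_log hW (h t ht1)
    rw [Real.log_mul (by positivity) (Real.exp_pos _).ne', Real.log_exp, Real.log_pow,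
      Real.log_mul hK.ne' ht0.ne'] at hl
    rw [div_le_iff₀ ht0]
    refine hl.trans (le_of_eq ?_)
    field_simp

theorem tendsto_log_moment_div [IsProbabilityMeasure P] [IsProbabilityMeasure Q] (hd : 1 ≤ d)
    (hn : 1 ≤ n) (hp : 1 ≤ p) (hY : ∀ k, IsSimpleRandomWalk ρ 0 (Y k) P)
    (hind : iIndepFun (fun k ω t => Y k t ω) P) (hX : IsSimpleRandomWalk κ x X Q)
    (hx : (κ, ρ) ≠ (0, 0) ∨ x = 0) :
    Tendsto (fun t : ℝ≥0 => Real.log (∫ w, Real.exp (totalExposure p Y X t w)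
      ∂(P.prod (Measure.pi fun _ : Fin p => Q))) / t) atTop (𝓝 (twoRateEnergy d p n (κ, ρ))) := by
  refine tendsto_log_div_of_bounds (fun ν hν => ?_) (exists_moment_le hd hY hind hX)
  obtain ⟨C, hC, h⟩ := exists_mul_exp_le_kernelFK_of_lt Sum.isLeft (twoRates p n κ ρ)
    (startConf p n x) (twoRateEnergy_le_of_reachable hp hn κ ρ x hx) hν
  refine ⟨C, hC, fun t ht => (h t (by exact_mod_cast ht)).trans ?_⟩
  exact kernelFK_le_moment hd hY hind hX (zero_lt_two.trans_le ht)

/-- At zero rates the displacement vanishes almost surely, so the whole moment is the return kernel,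
which is 1 as there are no contacts at the start. -/
theorem moment_eq_one_of_frozen [IsProbabilityMeasure P] [IsProbabilityMeasure Q] (hd : 1 ≤ d)
    (hY : ∀ k, IsSimpleRandomWalk 0 0 (Y k) P) (hind : iIndepFun (fun k ω t => Y k t ω) P)
    (hX : IsSimpleRandomWalk 0 x X Q) (hx : x ≠ 0) {t : ℝ≥0} (ht : 0 < t) :
    ∫ w, Real.exp (totalExposure p Y X t w) ∂(P.prod (Measure.pi fun _ : Fin p => Q)) = 1 := by
  have hfam := isStepFamily_jointStepLaw (p := p) (n := n) hd 0 0 t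
  have hprob := hfam.prob
  have hone : ∀ ι, (jointStepLaw d p n 0 0 t ι) {0} = 1 := by
    intro ι
    have h := hfam.zero_le ι
    have hr : twoRates p n 0 0 ι = 0 := by cases ι <;> rfl
    rw [hr] at h
    simp only [NNReal.coe_zero, mul_zero, zero_mul, neg_zero, Real.exp_zero] at h
    refine le_antisymm prob_le_one ?_
    rw [measureReal_def, ← ENNReal.ofReal_le_iff_le_toReal (measure_ne_top _ _)] at h
    simpa using h
  have hae : ∀ᵐ w ∂(P.prod (Measure.pi fun _ : Fin p => Q)), jointDisplacement p Y X t w = 0 := by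
    have hs : (P.prod (Measure.pi fun _ : Fin p => Q)).map (jointDisplacement p Y X t) {0} = 1 := by
      rw [map_jointDisplacement hd hY hind hX, Measure.pi_singleton]
      exact Finset.prod_eq_one fun ι _ => hone ι
    rw [Measure.map_apply (measurable_jointDisplacement hY hX t) (MeasurableSet.singleton _)] at hs
    exact (prob_compl_eq_zero_iff (measurable_jointDisplacement hY hX t
      (MeasurableSet.singleton _))).2 hs
  have h := integral_exp_totalExposure (p := p) hd hY hind hX ht 0
  have hz : initialConf x (0 : Conf (Fin p ⊕ Fin n) d) = startConf p n x := by
    funext ι; cases ι <;> simp [initialConf, startConf]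
  rw [add_zero, hz, kernelFK_twoRates_zero _ hx] at h
  rw [← h]
  refine integral_congr_ae ?_
  filter_upwards [hae] with w hw
  rw [if_pos hw, mul_one]

end Moments

end

theorem theorem1 (d n p : ℕ) (hd : 1 ≤ d) (hn : 1 ≤ n) (hp : 1 ≤ p) :
    ∃ lam : (Fin d → ℤ) → ℝ≥0 × ℝ≥0 → ℝ,
      -- for every starting point and all rates, the limit exists and is finite
      (∀ (x : Fin d → ℤ) (κ ρ : ℝ≥0)
        (Ω : Type*) [MeasurableSpace Ω] (P : Measure Ω) [IsProbabilityMeasure P]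
        (Y : Fin n → ℝ≥0 → Ω → (Fin d → ℤ))
        (Ω' : Type*) [MeasurableSpace Ω'] (Q : Measure Ω') [IsProbabilityMeasure Q]
        (X : ℝ≥0 → Ω' → (Fin d → ℤ)),
        (∀ k, IsSimpleRandomWalk ρ 0 (Y k) P) →
        iIndepFun (fun k ω t => Y k t ω) P →
        IsSimpleRandomWalk κ x X Q →
        Tendsto (momentRate p Y P X Q) atTop (𝓝 (lam x (κ, ρ)))) ∧
      -- it does not depend on the starting point unless both rates vanish
      (∀ κ ρ : ℝ≥0, (κ, ρ) ≠ (0, 0) → ∀ x y, lam x (κ, ρ) = lam y (κ, ρ)) ∧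
      -- continuity, convexity and monotonicity on `[0, ∞)²`
      Continuous (lam 0) ∧
      ConvexOn ℝ≥0 Set.univ (lam 0) ∧
      (∀ ρ : ℝ≥0, Antitone fun κ : ℝ≥0 => lam 0 (κ, ρ)) ∧
      (∀ κ : ℝ≥0, Antitone fun ρ : ℝ≥0 => lam 0 (κ, ρ)) := by
  have hp0 : (0 : ℝ) < p := by exact_mod_cast hp
  have hanti : ∀ a b : ℝ≥0 × ℝ≥0, a ≤ b →
      twoRateEnergy d p n b / p ≤ twoRateEnergy d p n a / p := fun a b hab =>
    div_le_div_of_nonneg_right (twoRateEnergy_anti hab) hp0.le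
  -- The exceptional value 0 belongs to immobile walks that never meet; division by `p` comes from
  -- the `p`-th root in the moment rate.
  refine ⟨fun x r => if r = (0, 0) ∧ x ≠ 0 then 0 else twoRateEnergy d p n r / p,
    ?_, ?_, ?_, ?_, ?_, ?_⟩
  · intro x κ ρ Ω _ P _ Y Ω' _ Q _ X hY hind hX
    beta_reduce
    by_cases hdeg : (κ, ρ) = (0, 0) ∧ x ≠ 0
    · rw [if_pos hdeg]
      obtain ⟨hκρ, hx⟩ := hdeg
      obtain ⟨rfl, rfl⟩ := Prod.mk.inj hκρ
      refine tendsto_const_nhds.congr' ?_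
      filter_upwards [eventually_gt_atTop 0] with t ht
      rw [momentRate, integral_pamSolution_pow hY hX ht,
        moment_eq_one_of_frozen hd hY hind hX hx ht]
      simp
    · rw [if_neg hdeg]
      have hx : (κ, ρ) ≠ (0, 0) ∨ x = 0 := by
        by_cases h : (κ, ρ) = (0, 0)
        · exact Or.inr (not_not.1 fun h' => hdeg ⟨h, h'⟩)
        · exact Or.inl h
      refine ((tendsto_log_moment_div hd hn hp hY hind hX hx).div_const (p : ℝ)).congr' ?_
      filter_upwards [eventually_gt_atTop 0] with t ht
      have hW : 0 < ∫ w, Real.exp (totalExposure p Y X t w)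
          ∂(P.prod (Measure.pi fun _ : Fin p => Q)) :=
        (kernelFK_self_pos _ _ t.coe_nonneg _).trans_le (kernelFK_le_moment hd hY hind hX ht)
      rw [momentRate, integral_pamSolution_pow hY hX ht, Real.log_rpow hW]
      field_simp
  · intro κ ρ h x y
    simp only [h, false_and, if_false]
  · simpa using continuous_twoRateEnergy.div_const (p : ℝ)
  · have h := (convexOn_twoRateEnergy (d := d) (p := p) (n := n)).smul
      (c := (p : ℝ≥0)⁻¹) (zero_le)
    refine h.congr fun r _ => ?_
    simp [NNReal.smul_def, div_eq_inv_mul]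
  · intro ρ a b hab
    simpa using hanti (a, ρ) (b, ρ) ⟨hab, le_rfl⟩
  · intro κ a b hab
    simpa using hanti (κ, a) (κ, b) ⟨le_rfl, hab⟩
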